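/- Let $\mathbf k$ be a field, $H\subseteq G$ finite groups, and $\alpha\colon G\times G\times G\to\mathbf k^\times$ a normalised 3-cocycle (trivial action): $\alpha(ab,c,d)\,\alpha(a,b,cd)=\alpha(b,c,d)\,\alpha(a,bc,d)\,\alpha(a,b,c)$, and $\alpha=1$ if one argument is $1$; its restriction to $H$ is again denoted $\alpha$. Let $\mathrm{Vect}^\alpha[G]$ be the monoidal category of finite-dimensional $G$-graded $\mathbf k$-vector spaces with the graded tensor product, whose associator $(U\otimes V)\otimes W\to U\otimes(V\otimes W)$ is the usual one multiplied by $\alpha(a,b,c)$ on $(U_a\otimes V_b)\otimes W_c$; similarly for $H$. For an algebra object $A$, write $\mathrm{Vect}^\alpha[G]\text{-}A$ for the category of right $A$-module objects, a left $\mathrm{Vect}^\alpha[G]$-module category. A projective 2-representation of $G$ with cocycle $\alpha$ on an additive $\mathbf k$-linear category $\mathcal V$ consists of $\mathbf k$-linear functors $\varrho(g)\colon\mathcal V\to\mathcal V$ and natural isomorphisms $\psi_{g,h}\colon\varrho(g)\varrho(h)\Rightarrow\varrho(gh)$, $\psi_1\colon\varrho(1)\Rightarrow\mathrm{id}$ with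 $\psi_{g,hk}(\varrho(g)\psi_{h,k})=\alpha(g,h,k)\,\psi_{gh,k}(\psi_{g,h}\varrho(k))$, $\psi_{1,g}=\psi_1\varrho(g)$ and $\psi_{g,1}=\varrho(g)\psi_1$. A 1-morphism $\varrho\to\pi$ is a $\mathbf k$-linear functor $F$ with natural isomorphisms $F\varrho(g)\cong\pi(g)F$ compatible with the $\psi$'s; a 2-morphism is a natural transformation compatible with these isomorphisms. A left $\mathrm{Vect}^\alpha[G]$-module category is regarded as a projective 2-representation by $\varrho(g)=\mathbf k_g\otimes-$, with $\psi_{g,h}$ and $\psi_1$ given by the associativity and unit isomorphisms and $\mathbf k_g\otimes\mathbf k_h\cong\mathbf k_{gh}$. Given a projective 2-representation $\varrho$ of $H$ (cocycle $\alpha|_H$), a projective 2-representation $\sigma$ of $G$ (cocycle $\alpha$) together with a 1-morphism $j\colon\varrho\to\sigma|_H$ of projective $H$-2-representations is *induced by* $\varrho$, written $\sigma=\mathrm{ind}_H^G\varrho$, if for every projective 2-representation $\pi$ of $G$ with cocycle $\alpha$ on an additive $\mathbf k$-linear category and every 1-morphism $F\colon\varrho\to\pi|_H$: (1) there are a 1-morphism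 $\bar F\colon\sigma\to\pi$ and a 2-isomorphism $\Phi\colon F\Rightarrow\bar F j$ of 1-morphisms of projective $H$-2-representations; (2) for any two such pairs $(\bar F_1,\Phi_1)$, $(\bar F_2,\Phi_2)$ there is a unique 2-isomorphism $\eta\colon\bar F_1\Rightarrow\bar F_2$ with $(\eta j)\circ\Phi_1=\Phi_2$. **Proposition.** Let $A$ be an algebra object in $\mathrm{Vect}^\alpha[H]$, and let $\mathcal M=\mathrm{Vect}^\alpha[H]\text{-}A$. Regard $A$ also as an algebra object in $\mathrm{Vect}^\alpha[G]$, extended by zero. Then $$\mathrm{ind}_H^G\mathcal M=\mathrm{Vect}^\alpha[G]\text{-}A,$$ and the 1-morphism $j$ is the canonical inclusion $\mathrm{Vect}^\alpha[H]\text{-}A\to\mathrm{Vect}^\alpha[G]\text{-}A$ extending modules by zero: $j(M)_h=M_h$ for $h\in H$ and $j(M)_g=0$ for $g\in G\setminus H$, with the canonical (identity) isomorphisms $j(\mathbf k_h\otimes M)\cong\mathbf k_h\otimes j(M)$. -/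

import Mathlib

open CategoryTheory MonoidalCategory Limits
open scoped TensorProduct

universe u v w

/-- A normalised 3-cocycle on the group `Γ` with values in `kˣ` (trivial action). -/
structure NormalizedCocycle (k : Type u) [Field k] (Γ : Type v) [Group Γ] where
  toFun : Γ → Γ → Γ → kˣ
  cocycle : ∀ a b c d : Γ, toFun (a * b) c d * toFun a b (c * d) =
    toFun b c d * toFun a (b * c) d * toFun a b c
  one_left : ∀ a b : Γ, toFun 1 a b = 1
  one_mid : ∀ a b : Γ, toFun a 1 b = 1
  one_right : ∀ a b : Γ, toFun a b 1 = 1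

/-- The restriction `α|_H` of a cocycle to a subgroup. -/
def NormalizedCocycle.restrict {k : Type u} [Field k] {G : Type v} [Group G]
    (α : NormalizedCocycle k G) (H : Subgroup G) : NormalizedCocycle k H where
  toFun a b c := α.toFun a b c
  cocycle a b c d := α.cocycle a b c d
  one_left a b := α.one_left a b
  one_mid a b := α.one_mid a b
  one_right a b := α.one_right a b

/-- An object of `Vect^α[Γ]`: a finite-dimensional `Γ`-graded `k`-vector space, for a finite
group `Γ`.  The grading is recorded by the projections `proj g` onto the homogeneous
components; the component of degree `g` is the range of `proj g`.  The cocycle `α` only enters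
the monoidal structure. -/
structure GradedVect {k : Type u} [Field k] {Γ : Type v} [Group Γ] [Fintype Γ]
    (α : NormalizedCocycle k Γ) where
  carrier : Type u
  [addCommGroup : AddCommGroup carrier]
  [module : Module k carrier]
  [finite : Module.Finite k carrier]
  proj : Γ → Module.End k carrier
  isGrading : CompleteOrthogonalIdempotents proj

namespace GradedVect

attribute [instance] addCommGroup module finite

section Basic

variable {k : Type u} [Field k] {Γ : Type v} [Group Γ] [Fintype Γ] {α : NormalizedCocycle k Γ}

/-- The homogeneous component of degree `g`. -/
def component (V : GradedVect α) (g : Γ) : Submodule k V.carrier :=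
  LinearMap.range (V.proj g)

theorem mem_component {V : GradedVect α} {g : Γ} {x : V.carrier} :
    x ∈ V.component g ↔ V.proj g x = x := by
  constructor
  · rintro ⟨y, rfl⟩
    exact LinearMap.congr_fun (V.isGrading.idem g) y
  · intro h
    exact ⟨x, h⟩

theorem proj_apply_of_mem [DecidableEq Γ] {V : GradedVect α} {g : Γ} {x : V.carrier}
    (hx : x ∈ V.component g) (s : Γ) : V.proj s x = if g = s then x else 0 := by
  split_ifs with h
  · subst h
    exact mem_component.1 hx
  · rw [← mem_component.1 hx]
    exact LinearMap.congr_fun (V.isGrading.ortho (Ne.symm h)) x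

theorem sum_proj (V : GradedVect α) (x : V.carrier) : ∑ g, V.proj g x = x := by
  have h := LinearMap.congr_fun V.isGrading.complete x
  simpa using h

/-- Linear maps agree as soon as they agree on homogeneous elements. -/
theorem linear_ext {V : GradedVect α} {W : Type w} [AddCommGroup W] [Module k W]
    {f f' : V.carrier →ₗ[k] W} (h : ∀ g, ∀ x ∈ V.component g, f x = f' x) : f = f' := by
  ext x
  rw [← V.sum_proj x, map_sum, map_sum]
  exact Finset.sum_congr rfl fun g _ => h g _ ⟨x, rfl⟩

/-- A graded vector space is the internal direct sum of its components. -/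
theorem isInternal_component [DecidableEq Γ] (V : GradedVect α) :
    DirectSum.IsInternal V.component := by
  classical
  rw [DirectSum.isInternal_submodule_iff_iSupIndep_and_iSup_eq_top]
  constructor
  · rw [iSupIndep_iff_forall_dfinsupp]
    intro i x v hv
    have hx : V.proj i (x : V.carrier) = x := mem_component.1 x.2
    rw [← hv, DFinsupp.lsum_apply_apply, DFinsupp.sumAddHom_apply, DFinsupp.sum, map_sum] at hx
    rw [Finset.sum_eq_zero] at hx
    · rw [DFinsupp.lsum_apply_apply, DFinsupp.sumAddHom_apply, DFinsupp.sum] at hv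
      ext
      rw [← hv]
      exact hx.symm
    · intro j _
      by_cases hj : j = i
      · subst hj
        simp
      · have : ((v.erase i j : V.component j) : V.carrier) ∈ V.component j := SetLike.coe_mem _
        simpa [hj] using proj_apply_of_mem this i
  · rw [eq_top_iff]
    intro x _
    rw [← V.sum_proj x]
    exact Submodule.sum_mem _ fun g _ => Submodule.mem_iSup_of_mem g ⟨x, rfl⟩

/-- Morphisms of graded vector spaces: linear maps that preserve degrees, that is, commute with
the projections onto the homogeneous components. -/
@[ext]
structure Hom (V W : GradedVect α) where
  lin : V.carrier →ₗ[k] W.carrier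
  comm : ∀ g, lin ∘ₗ V.proj g = W.proj g ∘ₗ lin

theorem Hom.comm_apply {V W : GradedVect α} (f : Hom V W) (g : Γ) (x : V.carrier) :
    f.lin (V.proj g x) = W.proj g (f.lin x) :=
  LinearMap.congr_fun (f.comm g) x

theorem Hom.map_mem {V W : GradedVect α} (f : Hom V W) {g : Γ} {x : V.carrier}
    (hx : x ∈ V.component g) : f.lin x ∈ W.component g := by
  rw [mem_component, ← f.comm_apply, mem_component.1 hx]

/-- A linear map that carries each component into the component of the same degree. -/
def Hom.ofMapMem {V W : GradedVect α} (f : V.carrier →ₗ[k] W.carrier)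
    (hf : ∀ g, ∀ x ∈ V.component g, f x ∈ W.component g) : Hom V W where
  lin := f
  comm g := by
    classical
    refine linear_ext fun s x hx => ?_
    simp only [LinearMap.comp_apply, proj_apply_of_mem hx, proj_apply_of_mem (hf s x hx)]
    split_ifs <;> simp

instance instCategory : Category (GradedVect α) where
  Hom := Hom
  id V := ⟨LinearMap.id, fun _ => rfl⟩
  comp f g := ⟨g.lin ∘ₗ f.lin, fun s => by
    ext x
    simp [f.comm_apply, g.comm_apply]⟩

@[ext]
theorem hom_ext {V W : GradedVect α} {f g : V ⟶ W} (h : Hom.lin f = Hom.lin g) : f = g :=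
  Hom.ext h

@[simp] theorem id_lin (V : GradedVect α) : Hom.lin (𝟙 V) = LinearMap.id := rfl
@[simp] theorem comp_lin {V W X : GradedVect α} (f : V ⟶ W) (g : W ⟶ X) :
    Hom.lin (f ≫ g) = Hom.lin g ∘ₗ Hom.lin f := rfl

/-- A morphism whose underlying linear map is an equivalence is an isomorphism. -/
def isoOfEquiv {V W : GradedVect α} (f : V ⟶ W) (e : V.carrier ≃ₗ[k] W.carrier)
    (h : Hom.lin f = e.toLinearMap) : V ≅ W where
  hom := f
  inv := ⟨e.symm.toLinearMap, fun g => by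
    ext x
    obtain ⟨y, rfl⟩ := e.surjective x
    have := Hom.comm_apply f g y
    simp only [h, LinearEquiv.coe_coe] at this
    simp [← this]⟩
  hom_inv_id := by
    apply hom_ext
    ext x
    change e.symm (Hom.lin f x) = x
    simp [h]
  inv_hom_id := by
    apply hom_ext
    ext x
    change Hom.lin f (e.symm x) = x
    simp [h]

/-! ### Linear structure -/

instance homZero (V W : GradedVect α) : Zero (V ⟶ W) := ⟨⟨0, fun g => by simp⟩⟩

instance homAdd (V W : GradedVect α) : Add (V ⟶ W) :=
  ⟨fun f g => ⟨Hom.lin f + Hom.lin g, fun s => by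
    rw [LinearMap.add_comp, LinearMap.comp_add, f.comm, g.comm]⟩⟩

instance homNeg (V W : GradedVect α) : Neg (V ⟶ W) :=
  ⟨fun f => ⟨-Hom.lin f, fun s => by rw [LinearMap.neg_comp, LinearMap.comp_neg, f.comm]⟩⟩

instance homAddCommGroup (V W : GradedVect α) : AddCommGroup (V ⟶ W) where
  add_assoc _ _ _ := Hom.ext (add_assoc _ _ _)
  zero_add _ := Hom.ext (zero_add _)
  add_zero _ := Hom.ext (add_zero _)
  neg_add_cancel _ := Hom.ext (neg_add_cancel _)
  add_comm _ _ := Hom.ext (add_comm _ _)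
  nsmul := nsmulRec
  zsmul := zsmulRec

@[simp] theorem zero_lin (V W : GradedVect α) : Hom.lin (0 : V ⟶ W) = 0 := rfl
@[simp] theorem add_lin {V W : GradedVect α} (f g : V ⟶ W) :
    Hom.lin (f + g) = Hom.lin f + Hom.lin g := rfl

instance instPreadditive : Preadditive (GradedVect α) where
  add_comp _ _ _ f f' g := Hom.ext (LinearMap.comp_add _ _ _)
  comp_add _ _ _ f g g' := Hom.ext (LinearMap.add_comp _ _ _)

instance instLinear : Linear k (GradedVect α) where
  homModule V W :=
    { smul := fun c f => ⟨c • Hom.lin f, fun s => by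
        rw [LinearMap.smul_comp, LinearMap.comp_smul, f.comm]⟩
      one_smul := fun _ => Hom.ext (one_smul _ _)
      mul_smul := fun _ _ _ => Hom.ext (mul_smul _ _ _)
      smul_zero := fun _ => Hom.ext (smul_zero _)
      smul_add := fun _ _ _ => Hom.ext (smul_add _ _ _)
      add_smul := fun _ _ _ => Hom.ext (add_smul _ _ _)
      zero_smul := fun _ => Hom.ext (zero_smul _ _) }
  smul_comp _ _ _ c f g := Hom.ext (LinearMap.comp_smul _ _ _)
  comp_smul _ _ _ f c g := Hom.ext (LinearMap.smul_comp _ _ _)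

@[simp] theorem smul_lin {V W : GradedVect α} (c : k) (f : V ⟶ W) :
    Hom.lin (c • f) = c • Hom.lin f := rfl

/-! ### The graded tensor product -/

section Tensor

open TensorProduct

/-- The projection onto degree `g` in the graded tensor product,
`(V ⊗ W)_g = ⨁_{ab = g} V_a ⊗ W_b`. -/
noncomputable def tensorProj (V W : GradedVect α) (g : Γ) :
    Module.End k (V.carrier ⊗[k] W.carrier) :=
  ∑ a : Γ, TensorProduct.map (V.proj a) (W.proj (a⁻¹ * g))

theorem tensorProj_tmul [DecidableEq Γ] {V W : GradedVect α} {a b : Γ} {x : V.carrier}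
    {y : W.carrier} (hx : x ∈ V.component a) (hy : y ∈ W.component b) (g : Γ) :
    tensorProj V W g (x ⊗ₜ[k] y) = if a * b = g then x ⊗ₜ[k] y else 0 := by
  simp only [tensorProj, LinearMap.sum_apply, TensorProduct.map_tmul, proj_apply_of_mem hx,
    proj_apply_of_mem hy]
  rw [Finset.sum_eq_single a]
  · simp only [if_true, eq_inv_mul_iff_mul_eq]
    split_ifs <;> simp
  · intro c _ hc
    simp [Ne.symm hc]
  · simp

theorem tensor_linear_ext {V W : GradedVect α} {X : Type w} [AddCommGroup X] [Module k X]
    {f f' : V.carrier ⊗[k] W.carrier →ₗ[k] X}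
    (h : ∀ a b, ∀ x ∈ V.component a, ∀ y ∈ W.component b, f (x ⊗ₜ y) = f' (x ⊗ₜ y)) :
    f = f' := by
  apply TensorProduct.ext
  refine linear_ext fun a x hx => ?_
  refine linear_ext fun b y hy => ?_
  exact h a b x hx y hy

/-- The graded tensor product. -/
noncomputable abbrev tensor (V W : GradedVect α) : GradedVect α where
  carrier := V.carrier ⊗[k] W.carrier
  proj := tensorProj V W
  isGrading := by
    classical
    rw [CompleteOrthogonalIdempotents.iff_ortho_complete]
    constructor
    · intro g h hgh
      refine tensor_linear_ext fun a b x hx y hy => ?_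
      simp only [Module.End.mul_apply, tensorProj_tmul hx hy, LinearMap.zero_apply]
      by_cases h1 : a * b = h
      · have h2 : a * b ≠ g := fun h2 => hgh (h2.symm.trans h1)
        rw [if_pos h1, tensorProj_tmul hx hy, if_neg h2]
      · simp [h1]
    · refine tensor_linear_ext fun a b x hx y hy => ?_
      simp [LinearMap.sum_apply, tensorProj_tmul hx hy]

theorem tmul_mem {V W : GradedVect α} {a b : Γ} {x : V.carrier} {y : W.carrier}
    (hx : x ∈ V.component a) (hy : y ∈ W.component b) :
    (x ⊗ₜ[k] y : V.carrier ⊗[k] W.carrier) ∈ (tensor V W).component (a * b) := by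
  classical
  refine mem_component.2 ?_
  change tensorProj V W (a * b) (x ⊗ₜ[k] y) = _
  rw [tensorProj_tmul hx hy, if_pos rfl]

end Tensor
end Basic
end GradedVect

namespace GradedVect

section Mon

variable {k : Type u} [Field k] {Γ : Type v} [Group Γ] [Fintype Γ] {α : NormalizedCocycle k Γ}

open Classical in
/-- The one-dimensional space `k_g`, concentrated in degree `g`. -/
noncomputable abbrev line (α : NormalizedCocycle k Γ) (g : Γ) : GradedVect α where
  carrier := k
  proj s := if g = s then 1 else 0
  isGrading := by
    rw [CompleteOrthogonalIdempotents.iff_ortho_complete]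
    constructor
    · intro s t hst
      by_cases h : g = s
      · have : g ≠ t := fun h' => hst (h.symm.trans h')
        simp [this]
      · simp [h]
    · simp

theorem mem_line (g : Γ) (c : k) : c ∈ (line α g).component g := by
  refine mem_component.2 ?_
  simp

theorem line_linear_ext {g : Γ} {W : Type w} [AddCommGroup W] [Module k W]
    {f f' : (line α g).carrier →ₗ[k] W} (h : f (1 : k) = f' (1 : k)) : f = f' :=
  LinearMap.ext_ring h

/-- The associator `(U ⊗ V) ⊗ W ⟶ U ⊗ (V ⊗ W)`: it is the usual one, multiplied by `α(a, b, c)`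
on `(U_a ⊗ V_b) ⊗ W_c`. -/
noncomputable def assocLin (U V W : GradedVect α) :
    (tensor (tensor U V) W).carrier →ₗ[k] (tensor U (tensor V W)).carrier :=
  (TensorProduct.assoc k U.carrier V.carrier W.carrier).toLinearMap ∘ₗ
    ∑ a : Γ, ∑ b : Γ, ∑ c : Γ, ((α.toFun a b c : kˣ) : k) •
      TensorProduct.map (TensorProduct.map (U.proj a) (V.proj b)) (W.proj c)

/-- The inverse of the associator. -/
noncomputable def assocInvLin (U V W : GradedVect α) :
    (tensor U (tensor V W)).carrier →ₗ[k] (tensor (tensor U V) W).carrier :=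
  (∑ a : Γ, ∑ b : Γ, ∑ c : Γ, (((α.toFun a b c)⁻¹ : kˣ) : k) •
      TensorProduct.map (TensorProduct.map (U.proj a) (V.proj b)) (W.proj c)) ∘ₗ
    (TensorProduct.assoc k U.carrier V.carrier W.carrier).symm.toLinearMap

theorem sum_proj_tmul (U V W : GradedVect α) {a b c : Γ} {x : U.carrier} {y : V.carrier}
    {z : W.carrier} (hx : x ∈ U.component a) (hy : y ∈ V.component b) (hz : z ∈ W.component c)
    (f : Γ → Γ → Γ → k) :
    (∑ a : Γ, ∑ b : Γ, ∑ c : Γ, f a b c •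
      TensorProduct.map (TensorProduct.map (U.proj a) (V.proj b)) (W.proj c))
      ((x ⊗ₜ[k] y) ⊗ₜ[k] z) = f a b c • ((x ⊗ₜ[k] y) ⊗ₜ[k] z) := by
  classical
  simp only [LinearMap.sum_apply, LinearMap.smul_apply, TensorProduct.map_tmul,
    proj_apply_of_mem hx, proj_apply_of_mem hy, proj_apply_of_mem hz]
  rw [Finset.sum_eq_single a, Finset.sum_eq_single b, Finset.sum_eq_single c]
  · simp
  all_goals simp +contextual [eq_comm]

theorem assocLin_tmul {U V W : GradedVect α} {a b c : Γ} {x : U.carrier} {y : V.carrier}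
    {z : W.carrier} (hx : x ∈ U.component a) (hy : y ∈ V.component b) (hz : z ∈ W.component c) :
    assocLin U V W ((x ⊗ₜ[k] y) ⊗ₜ[k] z) =
      ((α.toFun a b c : kˣ) : k) • (x ⊗ₜ[k] (y ⊗ₜ[k] z)) := by
  rw [assocLin, LinearMap.comp_apply]
  erw [sum_proj_tmul U V W hx hy hz]
  rw [map_smul]
  rfl

theorem assocInvLin_tmul {U V W : GradedVect α} {a b c : Γ} {x : U.carrier} {y : V.carrier}
    {z : W.carrier} (hx : x ∈ U.component a) (hy : y ∈ V.component b) (hz : z ∈ W.component c) :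
    assocInvLin U V W (x ⊗ₜ[k] (y ⊗ₜ[k] z)) =
      (((α.toFun a b c)⁻¹ : kˣ) : k) • ((x ⊗ₜ[k] y) ⊗ₜ[k] z) :=
  sum_proj_tmul U V W hx hy hz fun a b c => (((α.toFun a b c)⁻¹ : kˣ) : k)

theorem tensor_linear_ext_left {U V W : GradedVect α} {X : Type w} [AddCommGroup X] [Module k X]
    {f f' : (U.carrier ⊗[k] V.carrier) ⊗[k] W.carrier →ₗ[k] X}
    (h : ∀ a b c, ∀ x ∈ U.component a, ∀ y ∈ V.component b, ∀ z ∈ W.component c,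
      f ((x ⊗ₜ y) ⊗ₜ z) = f' ((x ⊗ₜ y) ⊗ₜ z)) :
    f = f' := by
  apply TensorProduct.ext
  refine tensor_linear_ext fun a b x hx y hy => ?_
  refine linear_ext fun c z hz => ?_
  exact h a b c x hx y hy z hz

theorem tensor_linear_ext_right {U V W : GradedVect α} {X : Type w} [AddCommGroup X]
    [Module k X] {f f' : U.carrier ⊗[k] (V.carrier ⊗[k] W.carrier) →ₗ[k] X}
    (h : ∀ a b c, ∀ x ∈ U.component a, ∀ y ∈ V.component b, ∀ z ∈ W.component c,
      f (x ⊗ₜ (y ⊗ₜ z)) = f' (x ⊗ₜ (y ⊗ₜ z))) :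
    f = f' := by
  apply TensorProduct.ext
  refine linear_ext fun a x hx => ?_
  refine tensor_linear_ext fun b c y hy z hz => ?_
  exact h a b c x hx y hy z hz

theorem tensor_linear_ext_four {U V W X : GradedVect α} {Y : Type w} [AddCommGroup Y]
    [Module k Y] {f f' : ((U.carrier ⊗[k] V.carrier) ⊗[k] W.carrier) ⊗[k] X.carrier →ₗ[k] Y}
    (h : ∀ a b c d, ∀ x ∈ U.component a, ∀ y ∈ V.component b, ∀ z ∈ W.component c,
      ∀ t ∈ X.component d, f (((x ⊗ₜ y) ⊗ₜ z) ⊗ₜ t) = f' (((x ⊗ₜ y) ⊗ₜ z) ⊗ₜ t)) :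
    f = f' := by
  apply TensorProduct.ext
  refine tensor_linear_ext_left fun a b c x hx y hy z hz => ?_
  refine linear_ext fun d t ht => ?_
  exact h a b c d x hx y hy z hz t ht

/-- A linear map out of a graded tensor product that preserves the degrees of the tensors of
homogeneous elements. -/
noncomputable def homOfTmul {U V W : GradedVect α} (f : U.carrier ⊗[k] V.carrier →ₗ[k] W.carrier)
    (hf : ∀ a b, ∀ x ∈ U.component a, ∀ y ∈ V.component b, f (x ⊗ₜ y) ∈ W.component (a * b)) :
    tensor U V ⟶ W where
  lin := f
  comm g := by
    classical
    refine tensor_linear_ext fun a b x hx y hy => ?_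
    change f (tensorProj U V g (x ⊗ₜ y)) = W.proj g (f (x ⊗ₜ y))
    rw [tensorProj_tmul hx hy, proj_apply_of_mem (hf a b x hx y hy)]
    split_ifs <;> simp

/-- The tensor product of morphisms. -/
noncomputable def tensorMap {U V U' V' : GradedVect α} (f : U ⟶ U') (g : V ⟶ V') :
    tensor U V ⟶ tensor U' V' :=
  homOfTmul (TensorProduct.map (Hom.lin f) (Hom.lin g)) fun _ _ _ hx _ hy =>
    tmul_mem (Hom.map_mem f hx) (Hom.map_mem g hy)

/-- The associator as an isomorphism of graded vector spaces. -/
noncomputable def assocIso (U V W : GradedVect α) :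
    tensor (tensor U V) W ≅ tensor U (tensor V W) where
  hom := ⟨assocLin U V W, fun g => by
    classical
    refine tensor_linear_ext_left fun a b c x hx y hy z hz => ?_
    change assocLin U V W ((tensor (tensor U V) W).proj g ((x ⊗ₜ y) ⊗ₜ z)) =
      (tensor U (tensor V W)).proj g (assocLin U V W ((x ⊗ₜ y) ⊗ₜ z))
    rw [proj_apply_of_mem (tmul_mem (tmul_mem hx hy) hz), assocLin_tmul hx hy hz, map_smul,
      proj_apply_of_mem (tmul_mem hx (tmul_mem hy hz)), mul_assoc]
    split_ifs
    · exact assocLin_tmul hx hy hz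
    · simp⟩
  inv := ⟨assocInvLin U V W, fun g => by
    classical
    refine tensor_linear_ext_right fun a b c x hx y hy z hz => ?_
    change assocInvLin U V W ((tensor U (tensor V W)).proj g (x ⊗ₜ (y ⊗ₜ z))) =
      (tensor (tensor U V) W).proj g (assocInvLin U V W (x ⊗ₜ (y ⊗ₜ z)))
    rw [proj_apply_of_mem (tmul_mem hx (tmul_mem hy hz)), assocInvLin_tmul hx hy hz, map_smul,
      proj_apply_of_mem (tmul_mem (tmul_mem hx hy) hz), mul_assoc]
    split_ifs
    · exact assocInvLin_tmul hx hy hz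
    · simp⟩
  hom_inv_id := by
    apply hom_ext
    refine tensor_linear_ext_left fun a b c x hx y hy z hz => ?_
    change assocInvLin U V W (assocLin U V W ((x ⊗ₜ y) ⊗ₜ z)) = _
    rw [assocLin_tmul hx hy hz, map_smul, assocInvLin_tmul hx hy hz, smul_smul]
    simp
  inv_hom_id := by
    apply hom_ext
    refine tensor_linear_ext_right fun a b c x hx y hy z hz => ?_
    change assocLin U V W (assocInvLin U V W (x ⊗ₜ (y ⊗ₜ z))) = _
    rw [assocInvLin_tmul hx hy hz, map_smul, assocLin_tmul hx hy hz, smul_smul]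
    simp

theorem eq_or_eq_zero_of_mem_line {g a : Γ} {c : k} (hc : c ∈ (line α g).component a) :
    g = a ∨ c = 0 := by
  classical
  by_cases h : g = a
  · exact Or.inl h
  · have := mem_component.1 hc
    simp only [h, if_false, LinearMap.zero_apply] at this
    exact Or.inr this.symm

/-- The left unitor is the usual one. -/
noncomputable def leftUnitorIso (V : GradedVect α) : tensor (line α 1) V ≅ V :=
  isoOfEquiv
    (homOfTmul (U := line α 1) (V := V) (TensorProduct.lid k V.carrier).toLinearMap (by
      intro a b c hc x hx
      rcases eq_or_eq_zero_of_mem_line hc with rfl | rfl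
      · rw [one_mul]
        exact Submodule.smul_mem _ c hx
      · change (0 : k) • x ∈ _
        rw [zero_smul]
        exact Submodule.zero_mem _))
    (TensorProduct.lid k V.carrier) rfl

/-- The right unitor is the usual one. -/
noncomputable def rightUnitorIso (V : GradedVect α) : tensor V (line α 1) ≅ V :=
  isoOfEquiv
    (homOfTmul (U := V) (V := line α 1) (TensorProduct.rid k V.carrier).toLinearMap (by
      intro a b x hx c hc
      rcases eq_or_eq_zero_of_mem_line hc with rfl | rfl
      · rw [mul_one]
        change c • x ∈ _
        exact Submodule.smul_mem _ c hx
      · change (0 : k) • x ∈ _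
        rw [zero_smul]
        exact Submodule.zero_mem _))
    (TensorProduct.rid k V.carrier) rfl

noncomputable instance monoidalStruct : MonoidalCategoryStruct (GradedVect α) where
  tensorObj := tensor
  whiskerLeft U _ _ f := tensorMap (𝟙 U) f
  whiskerRight f V := tensorMap f (𝟙 V)
  tensorHom := tensorMap
  tensorUnit := line α 1
  associator := assocIso
  leftUnitor := leftUnitorIso
  rightUnitor := rightUnitorIso

/-- The monoidal category `Vect^α[Γ]`. -/
noncomputable instance monoidal : MonoidalCategory (GradedVect α) where
  tensorHom_def f g := by
    apply hom_ext
    apply TensorProduct.ext'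
    intro x y
    rfl
  id_tensorHom_id U V := by
    apply hom_ext
    apply TensorProduct.ext'
    intro x y
    rfl
  tensorHom_comp_tensorHom f g f' g' := by
    apply hom_ext
    apply TensorProduct.ext'
    intro x y
    rfl
  whiskerLeft_id U V := by
    apply hom_ext
    apply TensorProduct.ext'
    intro x y
    rfl
  id_whiskerRight U V := by
    apply hom_ext
    apply TensorProduct.ext'
    intro x y
    rfl
  associator_naturality f g h := by
    apply hom_ext
    refine tensor_linear_ext_left fun a b c x hx y hy z hz => ?_
    change assocLin _ _ _ ((Hom.lin f x ⊗ₜ Hom.lin g y) ⊗ₜ Hom.lin h z) =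
      Hom.lin (tensorMap f (tensorMap g h)) (assocLin _ _ _ ((x ⊗ₜ y) ⊗ₜ z))
    rw [assocLin_tmul hx hy hz, assocLin_tmul (f.map_mem hx) (g.map_mem hy) (h.map_mem hz),
      map_smul]
    rfl
  leftUnitor_naturality f := by
    apply hom_ext
    apply TensorProduct.ext'
    intro c x
    exact (map_smul (Hom.lin f) c x).symm
  rightUnitor_naturality f := by
    apply hom_ext
    apply TensorProduct.ext'
    intro x c
    exact (map_smul (Hom.lin f) c x).symm
  pentagon U V W X := by
    apply hom_ext
    refine tensor_linear_ext_four fun a b c d x hx y hy z hz t ht => ?_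
    change Hom.lin (tensorMap (𝟙 U) (assocIso V W X).hom) (assocLin U (tensor V W) X
        (assocLin U V W ((x ⊗ₜ y) ⊗ₜ z) ⊗ₜ t)) =
      assocLin U V (tensor W X) (assocLin (tensor U V) W X (((x ⊗ₜ y) ⊗ₜ z) ⊗ₜ t))
    rw [assocLin_tmul hx hy hz, assocLin_tmul (tmul_mem hx hy) hz ht, map_smul,
      assocLin_tmul hx hy (tmul_mem hz ht), ← TensorProduct.smul_tmul', map_smul,
      assocLin_tmul hx (tmul_mem hy hz) ht, map_smul, map_smul]
    change _ • _ • (x ⊗ₜ[k] (assocLin V W X ((y ⊗ₜ z) ⊗ₜ t))) = _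
    rw [assocLin_tmul hy hz ht, TensorProduct.tmul_smul, smul_smul, smul_smul, smul_smul]
    congr 1
    have := congrArg (fun u : kˣ => (u : k)) (α.cocycle a b c d)
    simp only [Units.val_mul] at this
    rw [this]
    ring
  triangle U V := by
    apply hom_ext
    refine tensor_linear_ext_left (U := U) (V := line α 1) (W := V) fun a b c x hx y hy z hz => ?_
    change Hom.lin (tensorMap (𝟙 U) (leftUnitorIso V).hom)
      (assocLin U (line α 1) V ((x ⊗ₜ y) ⊗ₜ z)) = (y • x) ⊗ₜ z
    rw [assocLin_tmul hx hy hz, map_smul]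
    change _ • (x ⊗ₜ[k] (y • z)) = _
    rcases eq_or_eq_zero_of_mem_line hy with rfl | rfl
    · rw [α.one_mid, Units.val_one, one_smul, TensorProduct.tmul_smul]
      rfl
    · rw [zero_smul, zero_smul, TensorProduct.tmul_zero, TensorProduct.zero_tmul, smul_zero]

/-- The canonical isomorphism `k_g ⊗ k_h ≅ k_{gh}`, given by multiplication in `k`. -/
noncomputable def lineMul (α : NormalizedCocycle k Γ) (g h : Γ) :
    line α g ⊗ line α h ≅ line α (g * h) :=
  isoOfEquiv (V := tensor (line α g) (line α h)) (W := line α (g * h))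
    (homOfTmul (U := line α g) (V := line α h) (W := line α (g * h))
      (TensorProduct.lid k k).toLinearMap (by
      intro a b c hc d hd
      rcases eq_or_eq_zero_of_mem_line hc with rfl | rfl
      · rcases eq_or_eq_zero_of_mem_line hd with rfl | rfl
        · exact mem_line _ _
        · rw [TensorProduct.tmul_zero, map_zero]
          exact Submodule.zero_mem _
      · rw [TensorProduct.zero_tmul, map_zero]
        exact Submodule.zero_mem _))
    (TensorProduct.lid k k) rfl

instance monoidalPreadditive : MonoidalPreadditive (GradedVect α) where
  whiskerLeft_zero := by
    intros
    apply hom_ext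
    apply TensorProduct.ext'
    intro x y
    exact TensorProduct.tmul_zero _ _
  zero_whiskerRight := by
    intros
    apply hom_ext
    apply TensorProduct.ext'
    intro x y
    exact TensorProduct.zero_tmul _ _
  whiskerLeft_add := by
    intros
    apply hom_ext
    apply TensorProduct.ext'
    intro x y
    exact TensorProduct.tmul_add _ _ _
  add_whiskerRight := by
    intros
    apply hom_ext
    apply TensorProduct.ext'
    intro x y
    exact TensorProduct.add_tmul _ _ _

instance monoidalLinear : MonoidalLinear k (GradedVect α) where
  whiskerLeft_smul := by
    intros
    apply hom_ext
    apply TensorProduct.ext'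
    intro x y
    exact TensorProduct.tmul_smul _ _ _
  smul_whiskerRight := by
    intros
    apply hom_ext
    apply TensorProduct.ext'
    intro x y
    exact (TensorProduct.smul_tmul' _ _ _).symm

end Mon
end GradedVect

namespace GradedVect

section Extend

variable {k : Type u} [Field k] {G : Type v} [Group G] [Fintype G] {α : NormalizedCocycle k G}
  {H : Subgroup G} [Fintype H]

open Classical in
/-- Extension by zero of an `H`-graded vector space to a `G`-graded one. -/
noncomputable abbrev extendObj (V : GradedVect (α.restrict H)) : GradedVect α where
  carrier := V.carrier
  proj s := if hs : s ∈ H then V.proj ⟨s, hs⟩ else 0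
  isGrading := by
    rw [CompleteOrthogonalIdempotents.iff_ortho_complete]
    constructor
    · intro s t hst
      by_cases hs : s ∈ H
      · by_cases ht : t ∈ H
        · simp only [hs, ht, dif_pos]
          exact V.isGrading.ortho fun h => hst (congrArg Subtype.val h)
        · simp [ht]
      · simp [hs]
    · rw [Finset.sum_dite, Finset.sum_const_zero, add_zero, ← V.isGrading.complete]
      refine Finset.sum_bij' (fun s _ => ⟨s.1, (Finset.mem_filter.1 s.2).2⟩)
        (fun h _ => ⟨h.1, Finset.mem_filter.2 ⟨Finset.mem_univ _, h.2⟩⟩) ?_ ?_ ?_ ?_ ?_ <;> simp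

theorem component_extendObj (V : GradedVect (α.restrict H)) (h : H) :
    (extendObj V).component (h : G) = V.component h := by
  have : (extendObj V).proj (h : G) = V.proj h := dif_pos h.2
  exact congrArg LinearMap.range this

theorem component_extendObj_of_notMem (V : GradedVect (α.restrict H)) {g : G} (hg : g ∉ H) :
    (extendObj V).component g = ⊥ := by
  have : (extendObj V).proj g = 0 := dif_neg hg
  exact (congrArg LinearMap.range this).trans LinearMap.range_zero

theorem mem_extendObj {V : GradedVect (α.restrict H)} {h : H} {x : V.carrier}
    (hx : x ∈ V.component h) : x ∈ (extendObj V).component (h : G) := by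
  rw [component_extendObj]
  exact hx

/-- A linear map between extensions by zero that preserves the `H`-degrees. -/
noncomputable def homOfExtend {V : GradedVect (α.restrict H)} {W : GradedVect α}
    (f : V.carrier →ₗ[k] W.carrier)
    (hf : ∀ h : H, ∀ x ∈ V.component h, f x ∈ W.component (h : G)) : extendObj V ⟶ W where
  lin := f
  comm g := by
    classical
    refine linear_ext (V := V) fun h x hx => ?_
    change f ((extendObj V).proj g x) = W.proj g (f x)
    rw [proj_apply_of_mem (mem_extendObj hx), proj_apply_of_mem (hf h x hx)]
    split_ifs <;> simp

/-- Extension by zero as a functor. -/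
noncomputable abbrev extend (α : NormalizedCocycle k G) (H : Subgroup G) [Fintype H] :
    GradedVect (α.restrict H) ⥤ GradedVect α where
  obj := extendObj
  map f := homOfExtend (Hom.lin f) fun _ _ hx => mem_extendObj (Hom.map_mem f hx)

/-- The identity map `k_h ≅ k_h`, where the left-hand side is extended by zero from `H` and the
right-hand side is the line in degree `h ∈ G`. -/
noncomputable def extendLine (α : NormalizedCocycle k G) (H : Subgroup G) [Fintype H] (h : H) :
    extendObj (line (α.restrict H) h) ≅ line α (h : G) :=
  isoOfEquiv
    (homOfExtend (V := line (α.restrict H) h) (W := line α (h : G)) LinearMap.id (by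
      intro a c hc
      rcases eq_or_eq_zero_of_mem_line hc with rfl | rfl
      · exact mem_line _ _
      · exact Submodule.zero_mem _))
    (LinearEquiv.refl k k) rfl

/-- The identity map of `V ⊗ W`, as an isomorphism between the extension by zero of the tensor
product and the tensor product of the extensions. -/
noncomputable def extendTensor (V W : GradedVect (α.restrict H)) :
    extendObj (tensor V W) ≅ tensor (extendObj V) (extendObj W) :=
  isoOfEquiv
    (V := extendObj (tensor V W)) (W := tensor (extendObj V) (extendObj W))
    ⟨LinearMap.id, fun g => by
      classical
      refine tensor_linear_ext (V := V) (W := W) fun a b x hx y hy => ?_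
      change (extendObj (tensor V W)).proj g (x ⊗ₜ y) =
        (tensor (extendObj V) (extendObj W)).proj g (x ⊗ₜ y)
      rw [proj_apply_of_mem (mem_extendObj (tmul_mem hx hy)),
        proj_apply_of_mem (tmul_mem (mem_extendObj hx) (mem_extendObj hy))]
      rfl⟩
    (LinearEquiv.refl k _) rfl

/-- Extension by zero is a strong monoidal functor `Vect^{α|_H}[H] ⥤ Vect^α[G]`. -/
noncomputable instance extendMonoidal : (extend α H).Monoidal :=
  Functor.CoreMonoidal.toMonoidal
    { εIso := (extendLine α H 1).symm
      μIso := fun V W => (extendTensor V W).symm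
      μIso_hom_natural_left := by
        intros
        apply hom_ext
        apply TensorProduct.ext'
        intro x y
        rfl
      μIso_hom_natural_right := by
        intros
        apply hom_ext
        apply TensorProduct.ext'
        intro x y
        rfl
      associativity := by
        intro U V W
        apply hom_ext
        refine tensor_linear_ext_left (U := U) (V := V) (W := W) fun a b c x hx y hy z hz => ?_
        change assocLin U V W ((x ⊗ₜ y) ⊗ₜ z) =
          Hom.lin (tensorMap (𝟙 (extendObj U)) (extendTensor V W).symm.hom)
            (assocLin (extendObj U) (extendObj V) (extendObj W) ((x ⊗ₜ y) ⊗ₜ z))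
        rw [assocLin_tmul hx hy hz,
          assocLin_tmul (mem_extendObj hx) (mem_extendObj hy) (mem_extendObj hz), map_smul]
        rfl
      left_unitality := by
        intros
        apply hom_ext
        apply TensorProduct.ext'
        intro x y
        rfl
      right_unitality := by
        intros
        apply hom_ext
        apply TensorProduct.ext'
        intro x y
        rfl }

instance extendAdditive : (extend α H).Additive where
  map_add := rfl

instance extendLinear : (extend α H).Linear k where
  map_smul _ _ := rfl

end Extend
end GradedVect

section RightModules

open scoped MonObj

variable {C : Type u} [Category.{v} C] [MonoidalCategory C]

/-- A right module object over an algebra object `A` of a monoidal category. -/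
structure RightMod (A : C) [MonObj A] where
  X : C
  act : X ⊗ A ⟶ X
  act_one : X ◁ η[A] ≫ act = (ρ_ X).hom
  act_mul : act ▷ A ≫ act = (α_ X A A).hom ≫ X ◁ μ[A] ≫ act

namespace RightMod

variable {A : C} [MonObj A]

/-- Morphisms of right module objects. -/
@[ext]
structure Hom (M N : RightMod A) where
  hom : M.X ⟶ N.X
  act_hom : M.act ≫ hom = hom ▷ A ≫ N.act

instance instCategory : Category (RightMod A) where
  Hom := Hom
  id M := ⟨𝟙 M.X, by simp⟩
  comp f g := ⟨f.hom ≫ g.hom, by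
    rw [← Category.assoc, f.act_hom, Category.assoc, g.act_hom, comp_whiskerRight,
      Category.assoc]⟩
  id_comp _ := Hom.ext (Category.id_comp _)
  comp_id _ := Hom.ext (Category.comp_id _)
  assoc _ _ _ := Hom.ext (Category.assoc _ _ _)

@[ext]
theorem hom_ext {M N : RightMod A} {f g : M ⟶ N} (h : Hom.hom f = Hom.hom g) : f = g :=
  Hom.ext h

@[simp] theorem id_hom (M : RightMod A) : Hom.hom (𝟙 M) = 𝟙 M.X := rfl
@[simp] theorem comp_hom {M N P : RightMod A} (f : M ⟶ N) (g : N ⟶ P) :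
    Hom.hom (f ≫ g) = Hom.hom f ≫ Hom.hom g := rfl

/-- An isomorphism of the underlying objects that is compatible with the actions. -/
@[simps]
def mkIso {M N : RightMod A} (e : M.X ≅ N.X) (h : M.act ≫ e.hom = e.hom ▷ A ≫ N.act) :
    M ≅ N where
  hom := ⟨e.hom, h⟩
  inv := ⟨e.inv, by
    rw [← cancel_epi (e.hom ▷ A), ← Category.assoc, ← h, Category.assoc, e.hom_inv_id,
      Category.comp_id, ← Category.assoc, ← comp_whiskerRight, e.hom_inv_id, id_whiskerRight,
      Category.id_comp]⟩

section Linear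

variable [Preadditive C] [MonoidalPreadditive C]

instance homZero (M N : RightMod A) : Zero (M ⟶ N) := ⟨⟨0, by simp⟩⟩

instance homAdd (M N : RightMod A) : Add (M ⟶ N) :=
  ⟨fun f g => ⟨Hom.hom f + Hom.hom g, by
    rw [Preadditive.comp_add, f.act_hom, g.act_hom, MonoidalPreadditive.add_whiskerRight,
      Preadditive.add_comp]⟩⟩

instance homNeg (M N : RightMod A) : Neg (M ⟶ N) :=
  ⟨fun f => ⟨-Hom.hom f, by
    have h : (-Hom.hom f) ▷ A = -(Hom.hom f ▷ A) := (tensorRight A).map_neg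
    rw [Preadditive.comp_neg, f.act_hom, h, Preadditive.neg_comp]⟩⟩

instance homAddCommGroup (M N : RightMod A) : AddCommGroup (M ⟶ N) where
  add_assoc _ _ _ := Hom.ext (add_assoc _ _ _)
  zero_add _ := Hom.ext (zero_add _)
  add_zero _ := Hom.ext (add_zero _)
  neg_add_cancel _ := Hom.ext (neg_add_cancel _)
  add_comm _ _ := Hom.ext (add_comm _ _)
  nsmul := nsmulRec
  zsmul := zsmulRec

@[simp] theorem zero_hom (M N : RightMod A) : Hom.hom (0 : M ⟶ N) = 0 := rfl
@[simp] theorem add_hom {M N : RightMod A} (f g : M ⟶ N) :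
    Hom.hom (f + g) = Hom.hom f + Hom.hom g := rfl

instance instPreadditive : Preadditive (RightMod A) where
  add_comp _ _ _ f f' g := Hom.ext (Preadditive.add_comp _ _ _ _ _ _)
  comp_add _ _ _ f g g' := Hom.ext (Preadditive.comp_add _ _ _ _ _ _)

variable {k : Type w} [Field k] [Linear k C] [MonoidalLinear k C]

instance instLinear : Linear k (RightMod A) where
  homModule M N :=
    { smul := fun c f => ⟨c • Hom.hom f, by
        rw [Linear.comp_smul, f.act_hom, MonoidalLinear.smul_whiskerRight, Linear.smul_comp]⟩
      one_smul := fun _ => Hom.ext (one_smul _ _)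
      mul_smul := fun _ _ _ => Hom.ext (mul_smul _ _ _)
      smul_zero := fun _ => Hom.ext (smul_zero _)
      smul_add := fun _ _ _ => Hom.ext (smul_add _ _ _)
      add_smul := fun _ _ _ => Hom.ext (add_smul _ _ _)
      zero_smul := fun _ => Hom.ext (zero_smul _ _) }
  smul_comp _ _ _ c f g := Hom.ext (Linear.smul_comp _ _ _ _ _ _)
  comp_smul _ _ _ f c g := Hom.ext (Linear.comp_smul _ _ _ _ _ _)

@[simp] theorem smul_hom {M N : RightMod A} (c : k) (f : M ⟶ N) :
    Hom.hom (c • f) = c • Hom.hom f := rfl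

/-! Finite direct sums of right modules. -/

open ZeroObject in
instance hasZeroObject [HasZeroObject C] : HasZeroObject (RightMod A) := by
  refine ⟨⟨⟨0, 0, ?_, ?_⟩, ?_⟩⟩
  · exact (isZero_zero C).eq_of_tgt _ _
  · exact (isZero_zero C).eq_of_tgt _ _
  · rw [IsZero.iff_id_eq_zero]
    exact hom_ext ((isZero_zero C).eq_of_src _ _)

/-- The direct sum of two right modules. -/
noncomputable def directSum [HasBinaryBiproducts C] (M N : RightMod A) : RightMod A where
  X := M.X ⊞ N.X
  act := biprod.fst ▷ A ≫ M.act ≫ biprod.inl + biprod.snd ▷ A ≫ N.act ≫ biprod.inr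
  act_one := by
    rw [Preadditive.comp_add, whisker_exchange_assoc, whisker_exchange_assoc,
      reassoc_of% M.act_one, reassoc_of% N.act_one, rightUnitor_naturality_assoc,
      rightUnitor_naturality_assoc, ← Preadditive.comp_add, biprod.total, Category.comp_id]
  act_mul := by
    apply biprod.hom_ext
    · simp only [Category.assoc, Preadditive.add_comp, biprod.inl_fst, biprod.inr_fst,
        comp_zero, add_zero, Category.comp_id]
      rw [← comp_whiskerRight_assoc]
      simp only [Category.assoc, Preadditive.add_comp, biprod.inl_fst, biprod.inr_fst,
        comp_zero, add_zero, Category.comp_id, comp_whiskerRight, M.act_mul, whisker_exchange_assoc]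
      simp
    · simp only [Category.assoc, Preadditive.add_comp, biprod.inl_snd, biprod.inr_snd,
        comp_zero, zero_add, Category.comp_id]
      rw [← comp_whiskerRight_assoc]
      simp only [Category.assoc, Preadditive.add_comp, biprod.inl_snd, biprod.inr_snd,
        comp_zero, zero_add, Category.comp_id, comp_whiskerRight, N.act_mul, whisker_exchange_assoc]
      simp

/-- The direct sum of two right modules, as a bicone. -/
noncomputable def bicone [HasBinaryBiproducts C] (M N : RightMod A) : BinaryBicone M N where
  pt := directSum M N
  fst := ⟨biprod.fst, by simp [directSum]⟩
  snd := ⟨biprod.snd, by simp [directSum]⟩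
  inl := ⟨biprod.inl, by
    simp [directSum, ← comp_whiskerRight_assoc]⟩
  inr := ⟨biprod.inr, by
    simp [directSum, ← comp_whiskerRight_assoc]⟩
  inl_fst := hom_ext biprod.inl_fst
  inl_snd := hom_ext biprod.inl_snd
  inr_fst := hom_ext biprod.inr_fst
  inr_snd := hom_ext biprod.inr_snd

instance hasFiniteBiproducts [HasZeroObject C] [HasBinaryBiproducts C] : HasFiniteBiproducts (RightMod A) := by
  have : HasBinaryBiproducts (RightMod A) :=
    ⟨fun M N => hasBinaryBiproduct_of_total (bicone M N) (hom_ext biprod.total)⟩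
  have : HasFiniteProducts (RightMod A) := hasFiniteProducts_of_has_binary_and_terminal
  exact HasFiniteBiproducts.of_hasFiniteProducts

end Linear

open MonoidalLeftAction

/-- The right module `Z ⊗ M`. -/
abbrev actObj (Z : C) (M : RightMod A) : RightMod A where
  X := Z ⊗ M.X
  act := (α_ Z M.X A).hom ≫ Z ◁ M.act
  act_one := by
    rw [rightUnitor_tensor_hom, ← M.act_one, whiskerLeft_comp]
    simp
  act_mul := by
    have h := congrArg (fun t => Z ◁ t) M.act_mul
    simp only [whiskerLeft_comp] at h
    simp only [comp_whiskerRight, Category.assoc, associator_naturality_middle_assoc, h]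
    simp

/-- Right modules in `C` form a left module category over `C`. -/
instance leftAction : MonoidalLeftAction C (RightMod A) where
  actionObj := actObj
  actionHomLeft f M := ⟨f ▷ M.X, by simp [whisker_exchange]⟩
  actionHomRight Z _ _ f := ⟨Z ◁ Hom.hom f, by
    rw [Category.assoc, ← whiskerLeft_comp, f.act_hom]
    simp⟩
  actionAssocIso Z W M := mkIso (α_ Z W M.X) (by simp)
  actionUnitIso M := mkIso (λ_ M.X) (by simp)
  actionHom_def _ _ := rfl
  actionHomRight_id _ _ := hom_ext (whiskerLeft_id _ _)
  id_actionHomLeft _ _ := hom_ext (id_whiskerRight _ _)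
  actionHom_comp _ _ _ _ := by
    apply hom_ext; simp [whisker_exchange_assoc]
  actionAssocIso_hom_naturality _ _ _ := by
    apply hom_ext; simp [MonoidalCategory.tensorHom_def]
  actionUnitIso_hom_naturality _ := by
    apply hom_ext; simp
  whiskerLeft_actionHomLeft _ _ _ _ _ := by
    apply hom_ext; simp
  whiskerRight_actionHomLeft _ _ _ := by
    apply hom_ext; simp
  associator_actionHom _ _ _ _ := by
    apply hom_ext; simp
  leftUnitor_actionHom _ _ := by
    apply hom_ext; simp
  rightUnitor_actionHom _ _ := by
    apply hom_ext; simp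

end RightMod

open scoped Obj in
/-- A lax monoidal functor `F` carries right `A`-modules to right `F(A)`-modules. -/
@[simps]
def CategoryTheory.Functor.mapRightMod {C : Type*} [Category* C] [MonoidalCategory C] {D : Type*}
    [Category* D] [MonoidalCategory D] (F : C ⥤ D) [F.LaxMonoidal] (A : C) [MonObj A] :
    RightMod A ⥤ RightMod (F.obj A) where
  obj M :=
    { X := F.obj M.X
      act := Functor.LaxMonoidal.μ F M.X A ≫ F.map M.act
      act_one := by
        have h := congrArg (fun t => F.map t) M.act_one
        simp only [F.map_comp] at h
        simp [Functor.LaxMonoidal.right_unitality, ← h]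
      act_mul := by
        have h := congrArg (fun t => F.map t) M.act_mul
        simp only [F.map_comp] at h
        simp [h] }
  map f := ⟨F.map (RightMod.Hom.hom f), by
    have h := congrArg (fun t => F.map t) f.act_hom
    simp only [F.map_comp] at h
    simp [h]⟩
  map_id M := RightMod.hom_ext (F.map_id _)
  map_comp f g := RightMod.hom_ext (F.map_comp _ _)

end RightModules

namespace GradedVect

variable {k : Type u} [Field k] {Γ : Type v} [Group Γ] [Fintype Γ] {α : NormalizedCocycle k Γ}

/-- The zero graded vector space. -/
noncomputable def zeroObj : GradedVect α where
  carrier := PUnit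
  proj _ := 0
  isGrading := by
    rw [CompleteOrthogonalIdempotents.iff_ortho_complete]
    exact ⟨fun _ _ _ => Subsingleton.elim _ _, Subsingleton.elim _ _⟩

instance hasZeroObject : HasZeroObject (GradedVect α) := by
  refine ⟨⟨zeroObj, ?_⟩⟩
  rw [IsZero.iff_id_eq_zero]
  apply hom_ext
  apply LinearMap.ext
  intro x
  rfl

/-- The direct sum of two graded vector spaces. -/
noncomputable abbrev directSum (V W : GradedVect α) : GradedVect α where
  carrier := V.carrier × W.carrier
  proj g := (V.proj g).prodMap (W.proj g)
  isGrading := by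
    rw [CompleteOrthogonalIdempotents.iff_ortho_complete]
    constructor
    · intro g h hgh
      have h1 : V.proj g * V.proj h = 0 := V.isGrading.ortho hgh
      have h2 : W.proj g * W.proj h = 0 := W.isGrading.ortho hgh
      change (V.proj g).prodMap (W.proj g) * (V.proj h).prodMap (W.proj h) = 0
      rw [LinearMap.prodMap_mul, h1, h2, LinearMap.prodMap_zero]
    · apply LinearMap.ext
      rintro ⟨x, y⟩
      rw [LinearMap.sum_apply]
      refine Prod.ext ?_ ?_
      · rw [Prod.fst_sum]
        exact V.sum_proj x
      · rw [Prod.snd_sum]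
        exact W.sum_proj y

instance hasBinaryBiproducts : HasBinaryBiproducts (GradedVect α) where
  has_binary_biproduct V W := hasBinaryBiproduct_of_total
    { pt := directSum V W
      fst := ⟨LinearMap.fst k _ _, fun _ => rfl⟩
      snd := ⟨LinearMap.snd k _ _, fun _ => rfl⟩
      inl := ⟨LinearMap.inl k _ _, fun g => by
        apply LinearMap.ext
        intro x
        exact Prod.ext rfl (map_zero (W.proj g)).symm⟩
      inr := ⟨LinearMap.inr k _ _, fun g => by
        apply LinearMap.ext
        intro x
        exact Prod.ext (map_zero (V.proj g)).symm rfl⟩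
      inl_fst := rfl
      inl_snd := rfl
      inr_fst := rfl
      inr_snd := rfl }
    (by
      apply hom_ext
      apply LinearMap.ext
      rintro ⟨x, y⟩
      exact Prod.ext (add_zero x) (zero_add y))

theorem eqToHom_line_lin {g h : Γ} (e : g = h) (c : k) :
    Hom.lin (eqToHom (congrArg (line α) e)) c = c := by
  subst e
  rfl

theorem lineMul_assoc (g h l : Γ) :
    (α_ (line α g) (line α h) (line α l)).hom ≫ line α g ◁ (lineMul α h l).hom ≫
        (lineMul α g (h * l)).hom ≫ eqToHom (congrArg (line α) (mul_assoc g h l).symm) =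
      ((α.toFun g h l : kˣ) : k) • ((lineMul α g h).hom ▷ line α l ≫ (lineMul α (g * h) l).hom) := by
  apply hom_ext
  refine tensor_linear_ext_left (U := line α g) (V := line α h) (W := line α l)
    fun a b c x hx y hy z hz => ?_
  change Hom.lin (eqToHom (congrArg (line α) (mul_assoc g h l).symm))
    (Hom.lin (lineMul α g (h * l)).hom (Hom.lin (line α g ◁ (lineMul α h l).hom)
    (assocLin (line α g) (line α h) (line α l) ((x ⊗ₜ y) ⊗ₜ z)))) =
      ((α.toFun g h l : kˣ) : k) • (((x : k) * y) * z)
  refine (eqToHom_line_lin (mul_assoc g h l).symm _).trans ?_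
  rw [assocLin_tmul hx hy hz, map_smul, map_smul]
  rcases eq_or_eq_zero_of_mem_line hx with rfl | rfl
  · rcases eq_or_eq_zero_of_mem_line hy with rfl | rfl
    · rcases eq_or_eq_zero_of_mem_line hz with rfl | rfl
      · exact congrArg (_ • ·) (mul_assoc (x : k) y z).symm
      · simp
    · simp
  · simp

theorem lineMul_one_left (g : Γ) :
    (lineMul α 1 g).hom ≫ eqToHom (congrArg (line α) (one_mul g)) = (λ_ (line α g)).hom := by
  apply hom_ext
  apply TensorProduct.ext'
  intro x y
  exact eqToHom_line_lin (one_mul g) _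

theorem lineMul_one_right (g : Γ) :
    (lineMul α g 1).hom ≫ eqToHom (congrArg (line α) (mul_one g)) = (ρ_ (line α g)).hom := by
  apply hom_ext
  apply TensorProduct.ext'
  intro x y
  exact (eqToHom_line_lin (mul_one g) _).trans (mul_comm (x : k) y)

end GradedVect

section LinearAction

open MonoidalLeftAction

/-- A left action of a `k`-linear monoidal category on a `k`-linear category is `k`-linear if
the action functor is `k`-bilinear on morphisms. -/
class LinearLeftAction (k : Type*) [Field k] (C : Type*) [Category* C] [MonoidalCategory C]
    [Preadditive C] [Linear k C] (D : Type*) [Category* D] [Preadditive D] [Linear k D]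
    [MonoidalLeftAction C D] : Prop where
  add_left : ∀ {X Y : C} (f g : X ⟶ Y) (M : D), (f + g) ⊵ₗ M = f ⊵ₗ M + g ⊵ₗ M
  smul_left : ∀ {X Y : C} (c : k) (f : X ⟶ Y) (M : D), (c • f) ⊵ₗ M = c • f ⊵ₗ M
  add_right : ∀ (X : C) {M N : D} (f g : M ⟶ N), X ⊴ₗ (f + g) = X ⊴ₗ f + X ⊴ₗ g
  smul_right : ∀ (X : C) {M N : D} (c : k) (f : M ⟶ N), X ⊴ₗ (c • f) = c • X ⊴ₗ f

instance RightMod.linearLeftAction (k : Type*) [Field k] (C : Type*) [Category* C] [MonoidalCategory C]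
    [Preadditive C] [MonoidalPreadditive C] [Linear k C] [MonoidalLinear k C] (A : C) [MonObj A] :
    LinearLeftAction k C (RightMod A) where
  add_left _ _ _ := RightMod.hom_ext (MonoidalPreadditive.add_whiskerRight _ _)
  smul_left _ _ _ := RightMod.hom_ext (MonoidalLinear.smul_whiskerRight _ _ _)
  add_right _ _ _ _ _ := RightMod.hom_ext (MonoidalPreadditive.whiskerLeft_add _ _)
  smul_right _ _ _ _ _ := RightMod.hom_ext (MonoidalLinear.whiskerLeft_smul _ _ _)

end LinearAction

/-! ### Projective 2-representations -/

section TwoRep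

variable {k : Type u} [Field k] {Γ : Type v} [Group Γ]

/-- A projective 2-representation of `Γ` with cocycle `α` on a `k`-linear category `V`.
The functors `ρ g` are automatically autoequivalences. -/
structure ProjTwoRep (α : NormalizedCocycle k Γ) (V : Type*) [Category* V] [Preadditive V]
    [Linear k V] where
  ρ : Γ → V ⥤ V
  [additive : ∀ g, (ρ g).Additive]
  [linear : ∀ g, (ρ g).Linear k]
  /-- `ψ_{g,h} : ρ(g)ρ(h) ≅ ρ(gh)` -/
  ψ : ∀ g h, ρ h ⋙ ρ g ≅ ρ (g * h)
  /-- `ψ_1 : ρ(1) ≅ id` -/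
  ψ₁ : ρ 1 ≅ 𝟭 V
  ψ_assoc : ∀ (g h l : Γ) (X : V),
    (ρ g).map ((ψ h l).hom.app X) ≫ (ψ g (h * l)).hom.app X ≫
        eqToHom (congrArg (fun s => (ρ s).obj X) (mul_assoc g h l).symm) =
      ((α.toFun g h l : kˣ) : k) • ((ψ g h).hom.app ((ρ l).obj X) ≫ (ψ (g * h) l).hom.app X)
  ψ_one_left : ∀ (g : Γ) (X : V),
    (ψ 1 g).hom.app X ≫ eqToHom (congrArg (fun s => (ρ s).obj X) (one_mul g)) =
      ψ₁.hom.app ((ρ g).obj X)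
  ψ_one_right : ∀ (g : Γ) (X : V),
    (ψ g 1).hom.app X ≫ eqToHom (congrArg (fun s => (ρ s).obj X) (mul_one g)) =
      (ρ g).map (ψ₁.hom.app X)

namespace ProjTwoRep

attribute [instance] additive linear

variable {α : NormalizedCocycle k Γ}
  {V : Type*} [Category* V] [Preadditive V] [Linear k V]
  {W : Type*} [Category* W] [Preadditive W] [Linear k W]
  {X : Type*} [Category* X] [Preadditive X] [Linear k X]

/-- A 1-morphism of projective 2-representations: a `k`-linear functor `F` with natural
isomorphisms `F ρ(g) ≅ π(g) F` compatible with the structure 2-isomorphisms. -/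
structure Hom (σ : ProjTwoRep α V) (τ : ProjTwoRep α W) where
  functor : V ⥤ W
  [additive : functor.Additive]
  [linear : functor.Linear k]
  equiv : ∀ g, σ.ρ g ⋙ functor ≅ functor ⋙ τ.ρ g
  map_ψ : ∀ (g h : Γ) (M : V),
    functor.map ((σ.ψ g h).hom.app M) ≫ (equiv (g * h)).hom.app M =
      (equiv g).hom.app ((σ.ρ h).obj M) ≫ (τ.ρ g).map ((equiv h).hom.app M) ≫
        (τ.ψ g h).hom.app (functor.obj M)
  map_ψ₁ : ∀ M : V,
    functor.map (σ.ψ₁.hom.app M) = (equiv 1).hom.app M ≫ τ.ψ₁.hom.app (functor.obj M)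

attribute [instance] Hom.additive Hom.linear

/-- A 2-morphism between 1-morphisms of projective 2-representations: a natural transformation
compatible with the equivariance isomorphisms. -/
@[ext]
structure Hom₂ {σ : ProjTwoRep α V} {τ : ProjTwoRep α W} (F F' : Hom σ τ) where
  nat : F.functor ⟶ F'.functor
  comm : ∀ (g : Γ) (M : V),
    (F.equiv g).hom.app M ≫ (τ.ρ g).map (nat.app M) =
      nat.app ((σ.ρ g).obj M) ≫ (F'.equiv g).hom.app M

/-- Vertical composition of 2-morphisms; the isomorphisms of this category are the
2-isomorphisms. -/
instance homCategory {σ : ProjTwoRep α V} {τ : ProjTwoRep α W} : Category (Hom σ τ) where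
  Hom := Hom₂
  id F := ⟨𝟙 _, fun g M => by simp⟩
  comp η θ := ⟨η.nat ≫ θ.nat, fun g M => by
    rw [NatTrans.comp_app, NatTrans.comp_app, Functor.map_comp, ← Category.assoc, η.comm,
      Category.assoc, θ.comm, Category.assoc]⟩
  id_comp _ := Hom₂.ext (Category.id_comp _)
  comp_id _ := Hom₂.ext (Category.comp_id _)
  assoc _ _ _ := Hom₂.ext (Category.assoc _ _ _)

/-- Composition of 1-morphisms. -/
def Hom.comp {σ : ProjTwoRep α V} {τ : ProjTwoRep α W} {υ : ProjTwoRep α X} (F : Hom σ τ)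
    (E : Hom τ υ) : Hom σ υ where
  functor := F.functor ⋙ E.functor
  equiv g := NatIso.ofComponents
    (fun M => E.functor.mapIso ((F.equiv g).app M) ≪≫ (E.equiv g).app (F.functor.obj M)) (by
      intro M N f
      have h1 := (F.equiv g).hom.naturality f
      have h2 := (E.equiv g).hom.naturality (F.functor.map f)
      dsimp at h1 h2 ⊢
      rw [← Category.assoc, ← E.functor.map_comp, h1, E.functor.map_comp, Category.assoc, h2,
        Category.assoc])
  map_ψ g h M := by
    have h1 := congrArg E.functor.map (F.map_ψ g h M)
    have h2 := E.map_ψ g h (F.functor.obj M)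
    have h3 := (E.equiv g).hom.naturality ((F.equiv h).hom.app M)
    simp only [Functor.map_comp] at h1
    dsimp at h1 h2 h3 ⊢
    simp only [Functor.map_comp, Category.assoc]
    rw [← Category.assoc, h1]
    simp only [Category.assoc]
    rw [h2, reassoc_of% h3]
  map_ψ₁ M := by
    have h1 := congrArg E.functor.map (F.map_ψ₁ M)
    have h2 := E.map_ψ₁ (F.functor.obj M)
    simp only [Functor.map_comp] at h1
    dsimp at h1 h2 ⊢
    rw [h1, h2, Category.assoc]

/-- The whiskering `η j` of a 2-morphism `η` with a 1-morphism `j`. -/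
def whisker {σ : ProjTwoRep α V} {τ : ProjTwoRep α W} {υ : ProjTwoRep α X} (j : Hom σ τ)
    {E E' : Hom τ υ} (η : E ⟶ E') : j.comp E ⟶ j.comp E' where
  nat := Functor.whiskerLeft j.functor (Hom₂.nat η)
  comm g M := by
    have h1 := Hom₂.comm η g (j.functor.obj M)
    have h2 := (Hom₂.nat η).naturality ((j.equiv g).hom.app M)
    dsimp [Hom.comp] at h1 h2 ⊢
    rw [Category.assoc, h1, reassoc_of% h2]

section Restrict

variable (H : Subgroup Γ)

/-- The restriction of a projective 2-representation to a subgroup. -/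
def restrict (σ : ProjTwoRep α V) : ProjTwoRep (α.restrict H) V where
  ρ h := σ.ρ h
  ψ g h := σ.ψ g h
  ψ₁ := σ.ψ₁
  ψ_assoc g h l := σ.ψ_assoc g h l
  ψ_one_left g := σ.ψ_one_left g
  ψ_one_right g := σ.ψ_one_right g

/-- The restriction of a 1-morphism to a subgroup. -/
def Hom.restrict {σ : ProjTwoRep α V} {τ : ProjTwoRep α W} (F : Hom σ τ) :
    Hom (σ.restrict H) (τ.restrict H) where
  functor := F.functor
  equiv h := F.equiv h
  map_ψ g h := F.map_ψ g h
  map_ψ₁ := F.map_ψ₁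

/-- The restriction of a 2-morphism to a subgroup. -/
def restrictHom₂ {σ : ProjTwoRep α V} {τ : ProjTwoRep α W} {F F' : Hom σ τ} (η : F ⟶ F') :
    F.restrict H ⟶ F'.restrict H where
  nat := Hom₂.nat (F := F) (F' := F') η
  comm h := Hom₂.comm (F := F) (F' := F') η h

end Restrict

end ProjTwoRep
end TwoRep

section ModuleCategory

open MonoidalLeftAction

theorem eqToHom_actionHomLeft {C : Type*} [Category* C] [MonoidalCategory C] {D : Type*}
    [Category* D] [MonoidalLeftAction C D] {Γ : Type*} (L : Γ → C) {g h : Γ} (e : g = h) (X : D) :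
    (eqToHom (congrArg L e)) ⊵ₗ X = eqToHom (congrArg (fun s => L s ⊙ₗ X) e) := by
  subst e
  exact id_actionHomLeft _ _

theorem LinearLeftAction.assoc_eq {k : Type*} [Field k] {C : Type*} [Category* C]
    [MonoidalCategory C] [Preadditive C] [Linear k C] {D : Type*} [Category* D] [Preadditive D]
    [Linear k D] [MonoidalLeftAction C D] [LinearLeftAction k C D] {A B L P Q R S : C}
    (m : A ⊗ B ⟶ P) (n : B ⊗ L ⟶ Q) (p : A ⊗ Q ⟶ R) (q : P ⊗ L ⟶ S) (e : R ⟶ S) (c : k)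
    (h : (α_ A B L).hom ≫ A ◁ n ≫ p ≫ e = c • (m ▷ L ≫ q)) (X : D) :
    A ⊴ₗ ((αₗ B L X).inv ≫ n ⊵ₗ X) ≫ ((αₗ A Q X).inv ≫ p ⊵ₗ X) ≫ e ⊵ₗ X =
      c • (((αₗ A B (L ⊙ₗ X)).inv ≫ m ⊵ₗ (L ⊙ₗ X)) ≫ (αₗ P L X).inv ≫ q ⊵ₗ X) := by
  have h1 := congrArg (· ⊵ₗ X) h
  simp only [comp_actionHomLeft, LinearLeftAction.smul_left, whiskerLeft_actionHomLeft,
    whiskerRight_actionHomLeft, Category.assoc] at h1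
  have h2 := associator_actionHom A B L X
  rw [← cancel_epi (αₗ A B (L ⊙ₗ X)).hom, ← cancel_epi (αₗ (A ⊗ B) L X).hom]
  simp only [Linear.comp_smul, Category.assoc, Iso.hom_inv_id_assoc]
  rw [← h1, ← reassoc_of% h2, actionHomRight_comp_assoc, actionHomRight_hom_inv_assoc]

variable {k : Type u} [Field k] {Γ : Type v} [Group Γ] [Fintype Γ]

/-- The projective 2-representation given by a `k`-linear left `Vect^α[Γ]`-module category:
`ρ(g) = k_g ⊙ -`. -/
noncomputable def ProjTwoRep.ofModuleCategory (α : NormalizedCocycle k Γ) (V : Type*) [Category* V]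
    [Preadditive V] [Linear k V] [MonoidalLeftAction (GradedVect α) V]
    [LinearLeftAction k (GradedVect α) V] : ProjTwoRep α V where
  ρ g :=
    { obj := fun M => GradedVect.line α g ⊙ₗ M
      map := fun f => GradedVect.line α g ⊴ₗ f
      map_id := fun M => actionHomRight_id _ M
      map_comp := fun f f' => actionHomRight_comp _ f f' }
  additive g := ⟨fun {_ _ f f'} => LinearLeftAction.add_right k _ f f'⟩
  linear g := ⟨fun {_ _} f c => LinearLeftAction.smul_right _ c f⟩
  ψ g h := NatIso.ofComponents
    (fun M => (αₗ (GradedVect.line α g) (GradedVect.line α h) M).symm ≪≫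
      { hom := (GradedVect.lineMul α g h).hom ⊵ₗ M
        inv := (GradedVect.lineMul α g h).inv ⊵ₗ M }) (by
      intro M N f
      have h1 := action_exchange (GradedVect.lineMul α g h).hom f
      rw [tensor_actionHomRight] at h1
      change _ ⊴ₗ _ ⊴ₗ f ≫ (αₗ _ _ N).inv ≫ _ ⊵ₗ N = ((αₗ _ _ M).inv ≫ _ ⊵ₗ M) ≫ _ ⊴ₗ f
      rw [Category.assoc, ← h1]
      simp)
  ψ₁ := NatIso.ofComponents (fun M => λₗ[GradedVect α] M) (fun f =>
    (actionUnitIso_hom_naturality f).symm)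
  ψ_assoc g h l X := by
    have e := LinearLeftAction.assoc_eq _ _ _ _ _ _ (GradedVect.lineMul_assoc (α := α) g h l) X
    rw [eqToHom_actionHomLeft (GradedVect.line α) (mul_assoc g h l).symm] at e
    exact e
  ψ_one_left g X := by
    have h := congrArg (· ⊵ₗ X) (GradedVect.lineMul_one_left (α := α) g)
    simp only [comp_actionHomLeft, leftUnitor_actionHom,
      eqToHom_actionHomLeft (GradedVect.line α) (one_mul g)] at h
    change ((αₗ _ _ X).inv ≫ _ ⊵ₗ X) ≫ eqToHom _ = (λₗ[GradedVect α] (_ ⊙ₗ X)).hom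
    rw [Category.assoc, Iso.inv_comp_eq]
    exact h
  ψ_one_right g X := by
    have h := congrArg (· ⊵ₗ X) (GradedVect.lineMul_one_right (α := α) g)
    simp only [comp_actionHomLeft, rightUnitor_actionHom,
      eqToHom_actionHomLeft (GradedVect.line α) (mul_one g)] at h
    change ((αₗ _ _ X).inv ≫ _ ⊵ₗ X) ≫ eqToHom _ = _ ⊴ₗ (λₗ[GradedVect α] X).hom
    rw [Category.assoc, Iso.inv_comp_eq]
    exact h

end ModuleCategory

section Induction

variable {k : Type u} [Field k] {G : Type v} [Group G]

/-- `σ` on `V`, together with the 1-morphism `j` of projective 2-representations of `H`, is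
induced by `ρ`.  The test objects are all projective 2-representations `π` of `G` on additive
`k`-linear categories `N`.  First, every 1-morphism `F : ρ ⟶ π` of projective
2-representations of `H` factors as `F ≅ F̄ j` up to a 2-isomorphism `Φ`; second, for two such
pairs `(F̄₁, Φ₁)` and `(F̄₂, Φ₂)` there is a unique 2-isomorphism `θ : F̄₁ ≅ F̄₂` with
`(θ j) ∘ Φ₁ = Φ₂`. -/
def IsInduced.{u₁, v₁, u₂, v₂, u₃, v₃} {α : NormalizedCocycle k G} {H : Subgroup G}
    {W : Type u₁} [Category.{v₁} W] [Preadditive W] [Linear k W] [HasFiniteBiproducts W]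
    {V : Type u₂} [Category.{v₂} V] [Preadditive V] [Linear k V] [HasFiniteBiproducts V]
    (ρ : ProjTwoRep (α.restrict H) W) (σ : ProjTwoRep α V)
    (j : ProjTwoRep.Hom ρ (σ.restrict H)) : Prop :=
  ∀ (N : Type u₃) [Category.{v₃} N] [Preadditive N] [Linear k N] [HasFiniteBiproducts N]
    (π : ProjTwoRep α N) (F : ProjTwoRep.Hom ρ (π.restrict H)),
    (∃ F' : ProjTwoRep.Hom σ π, Nonempty (F ≅ j.comp (F'.restrict H))) ∧
    ∀ (F₁ F₂ : ProjTwoRep.Hom σ π) (Φ₁ : F ≅ j.comp (F₁.restrict H))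
      (Φ₂ : F ≅ j.comp (F₂.restrict H)),
      ∃! θ : F₁ ≅ F₂,
        Φ₁.hom ≫ ProjTwoRep.whisker j (ProjTwoRep.restrictHom₂ H θ.hom) = Φ₂.hom

variable [Fintype G]

/-- The extension by zero of an algebra object in `Vect^α[H]` is an algebra object in
`Vect^α[G]`. -/
noncomputable instance GradedVect.extendMonObj (α : NormalizedCocycle k G) (H : Subgroup G) [Fintype H]
    (A : GradedVect (α.restrict H)) [MonObj A] : MonObj ((GradedVect.extend α H).obj A) :=
  Functor.monObjObj (F := GradedVect.extend α H) A

/-- The projective 2-representation of `G` on the category `Vect^α[G]-A` of right `A`-modules. -/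
noncomputable abbrev rightModRep (α : NormalizedCocycle k G) (A : GradedVect α) [MonObj A] :
    ProjTwoRep α (RightMod A) :=
  ProjTwoRep.ofModuleCategory α (RightMod A)

namespace GradedVect

variable (α : NormalizedCocycle k G) (H : Subgroup G) [Fintype H]
  (A : GradedVect (α.restrict H)) [MonObj A]

/-- The functor `Vect^α[H]-A ⥤ Vect^α[G]-A` extending modules by zero. -/
noncomputable abbrev extendMod : RightMod A ⥤ RightMod ((extend α H).obj A) :=
  (extend α H).mapRightMod A

variable {α H} in
theorem mem_line_coe {h a : H} {c : k} (hc : c ∈ (line (α.restrict H) h).component a) :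
    c ∈ (line α (h : G)).component (a : G) := by
  rcases eq_or_eq_zero_of_mem_line hc with rfl | rfl
  · exact mem_line _ c
  · exact Submodule.zero_mem _

/-- The identity map of `k_h ⊗ V`, from the extension by zero of `k_h ⊗ V` to the tensor product
of `k_h` with the extension by zero of `V`. -/
noncomputable def extendLineTensor (h : H) (V : GradedVect (α.restrict H)) :
    (extend α H).obj (line (α.restrict H) h ⊗ V) ≅ line α (h : G) ⊗ (extend α H).obj V :=
  extendTensor (line (α.restrict H) h) V ≪≫ whiskerRightIso (extendLine α H h) (extendObj V)

theorem extendLineTensor_apply (h : H) (V : GradedVect (α.restrict H))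
    (x : (line (α.restrict H) h ⊗ V).carrier) :
    Hom.lin (extendLineTensor α H h V).hom x = x := by
  have : Hom.lin (extendLineTensor α H h V).hom = LinearMap.id := by
    apply TensorProduct.ext'
    intro x y
    rfl
  exact LinearMap.congr_fun this x

/-- The canonical isomorphism `j(k_h ⊗ M) ≅ k_h ⊗ j(M)` of right modules; it is the identity on
underlying vector spaces. -/
noncomputable def extendModIso (h : H) (M : RightMod A) :
    (extendMod α H A).obj (RightMod.actObj (line (α.restrict H) h) M) ≅
      RightMod.actObj (line α (h : G)) ((extendMod α H A).obj M) :=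
  RightMod.mkIso (extendLineTensor α H h M.X) (by
    apply hom_ext
    refine tensor_linear_ext_left (U := line (α.restrict H) h) (V := M.X) (W := A)
      fun a b c x hx y hy z hz => ?_
    change Hom.lin (extendLineTensor α H h M.X).hom (Hom.lin (line (α.restrict H) h ◁ M.act)
        (assocLin (line (α.restrict H) h) M.X A ((x ⊗ₜ y) ⊗ₜ z))) =
      Hom.lin (line α (h : G) ◁ ((extendMod α H A).obj M).act)
        (assocLin (line α (h : G)) (extendObj M.X) (extendObj A) ((x ⊗ₜ y) ⊗ₜ z))
    rw [extendLineTensor_apply, assocLin_tmul hx hy hz,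
      assocLin_tmul (mem_line_coe (k := k) hx) (mem_extendObj hy) (mem_extendObj hz), map_smul]
    exact (LinearMap.map_smul (Hom.lin (line α (h : G) ◁ ((extendMod α H A).obj M).act)) _ _).symm)

instance extendModAdditive : (extendMod α H A).Additive where
  map_add := rfl

instance extendModLinear : (extendMod α H A).Linear k where
  map_smul _ _ := rfl

/-- The canonical inclusion `j : Vect^α[H]-A ⟶ Vect^α[G]-A`, extension by zero, as a 1-morphism
of projective 2-representations of `H`. -/
noncomputable def inclusion :
    ProjTwoRep.Hom (rightModRep (α.restrict H) A)
      ((rightModRep α ((extend α H).obj A)).restrict H) where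
  functor := extendMod α H A
  equiv h := NatIso.ofComponents (fun M => extendModIso α H A h M) (by
    intro M N f
    apply RightMod.hom_ext
    apply hom_ext
    apply TensorProduct.ext'
    intro x y
    rfl)
  map_ψ g h M := by
    apply RightMod.hom_ext
    apply hom_ext
    refine tensor_linear_ext_right (U := line (α.restrict H) g) (V := line (α.restrict H) h)
      (W := M.X) fun a b c x hx y hy z hz => ?_
    change Hom.lin (extendLineTensor α H (g * h) M.X).hom
        (Hom.lin ((lineMul (α.restrict H) g h).hom ▷ M.X)
          (assocInvLin (line (α.restrict H) g) (line (α.restrict H) h) M.X (x ⊗ₜ (y ⊗ₜ z)))) =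
      Hom.lin ((lineMul α (g : G) (h : G)).hom ▷ extendObj M.X)
        (assocInvLin (line α (g : G)) (line α (h : G)) (extendObj M.X) (x ⊗ₜ (y ⊗ₜ z)))
    rw [extendLineTensor_apply, assocInvLin_tmul hx hy hz,
      assocInvLin_tmul (mem_line_coe (k := k) hx) (mem_line_coe (k := k) hy) (mem_extendObj hz), map_smul, map_smul]
    rfl
  map_ψ₁ M := by
    apply RightMod.hom_ext
    apply hom_ext
    apply TensorProduct.ext'
    intro x y
    rfl

end GradedVect

end Induction

/-!
The category of right modules over an algebra `A` of `Vect^α[H]`, extended by zero to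
`Vect^α[G]`, is induced because every `G`-graded module splits along the cosets of `H`.  As `A` is
concentrated in degrees from `H`, the action on a module `M` preserves the sum of the components
with degree in a coset `gH` (`GradedVect.act_cosetProj`), and this summand is `k_g ⊗ j(N)`, where
`N` is the part of `k_{g⁻¹} ⊗ M` with degrees in `H` (`GradedVect.exists_summand`).  Moreover `j` is
fully faithful, and there are no nonzero morphisms between summands that belong to different cosets
(`GradedVect.hom_eq_zero_of_coset_ne`).

These three facts imply the universal property for any 1-morphism `j : ρ ⟶ σ|_H`, where `σ` acts on
a category `V` (`ProjTwoRep.CosetDecomposition.isInduced`).  Choose a representative `g_c` of each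
coset `c`, so that `M ≅ ⨁_c σ(g_c) j(R_c M)` for functors `R_c`.

* An additive functor on `V` and its natural transformations are determined by their values on the
  objects `σ(g) j(A)`.  The morphisms between these objects are generated by the `σ(g) j(u)` and by
  the isomorphisms `σ(g) j(ρ(h) A) ≅ σ(gh) j(A)`, called `Hom.slide`; a family of morphisms that is
  natural with respect to both kinds extends to all of `V`
  (`ProjTwoRep.CosetDecomposition.exists_natTrans`).
* A factorisation of `F : ρ ⟶ π|_H` through `j` amounts to a `k`-linear functor `S` together with a
  `Frame`, that is, isomorphisms `S(σ(g) j(A)) ≅ π(g) F(A)` compatible with both kinds of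
  generators.  A frame determines the equivariance isomorphisms of `S`
  (`ProjTwoRep.Frame.equivariance`), and the comparison of two frames gives the unique 2-isomorphism
  between two factorisations.
* The functor `M ↦ ⨁_c π(g_c) F(R_c M)` has a frame
  (`ProjTwoRep.CosetDecomposition.extensionFrame`).

The cocycle is harmless: it enters through `ProjTwoRep.Hom.slide_assoc` and
`ProjTwoRep.Hom.map_slide_ψ` with the same scalar for `j` as for `F`, and through `ψ_assoc` with the
same scalar for `σ` as for `π`, so that it cancels in every comparison.
-/

/-! ### Sliding elements of the subgroup through a 1-morphism -/

namespace ProjTwoRep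

section Slide

variable {k : Type u} [Field k] {G : Type v} [Group G] {α : NormalizedCocycle k G}
  {H : Subgroup G} {W : Type*} [Category* W] [Preadditive W] [Linear k W]
  {X : Type*} [Category* X] [Preadditive X] [Linear k X]
  {ρ : ProjTwoRep (α.restrict H) W} {τ : ProjTwoRep α X} (E : Hom ρ (τ.restrict H))

/-- The equivariance isomorphism `E ρ(h) N ≅ τ(h) E N` of a 1-morphism `E : ρ ⟶ τ|_H`, with
its target expressed through `τ` itself. -/
def Hom.equivAt (h : H) (N : W) :
    E.functor.obj ((ρ.ρ h).obj N) ≅ (τ.ρ h).obj (E.functor.obj N) :=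
  (E.equiv h).app N

theorem Hom.equivAt_naturality (h : H) {N N' : W} (f : N ⟶ N') :
    E.functor.map ((ρ.ρ h).map f) ≫ (E.equivAt h N').hom =
      (E.equivAt h N).hom ≫ (τ.ρ h).map (E.functor.map f) :=
  (E.equiv h).hom.naturality f

theorem Hom.map_ψ_equivAt (h l : H) (N : W) :
    E.functor.map ((ρ.ψ h l).hom.app N) ≫ (E.equivAt (h * l) N).hom =
      (E.equivAt h ((ρ.ρ l).obj N)).hom ≫ (τ.ρ h).map (E.equivAt l N).hom ≫
        (τ.ψ h l).hom.app (E.functor.obj N) :=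
  E.map_ψ h l N

/-- The isomorphism `τ(g) E ρ(h) N ≅ τ(gh) E N` attached to a 1-morphism `E : ρ ⟶ τ|_H`.  The
product `gh` is recorded as an element `s` with `g * h = s`. -/
def Hom.slide {g s : G} (h : H) (e : g * h = s) (N : W) :
    (τ.ρ g).obj (E.functor.obj ((ρ.ρ h).obj N)) ≅ (τ.ρ s).obj (E.functor.obj N) :=
  (τ.ρ g).mapIso (E.equivAt h N) ≪≫ (τ.ψ g h).app (E.functor.obj N) ≪≫
    eqToIso (congrArg (fun x => (τ.ρ x).obj (E.functor.obj N)) e)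

theorem Hom.slide_hom {g : G} (h : H) (N : W) :
    (E.slide (g := g) h rfl N).hom =
      (τ.ρ g).map (E.equivAt h N).hom ≫ (τ.ψ g h).hom.app (E.functor.obj N) := by
  simp [slide]

theorem Hom.slide_naturality {g s : G} (h : H) (e : g * h = s) {N N' : W} (f : N ⟶ N') :
    (τ.ρ g).map (E.functor.map ((ρ.ρ h).map f)) ≫ (E.slide h e N').hom =
      (E.slide h e N).hom ≫ (τ.ρ s).map (E.functor.map f) := by
  subst e
  rw [slide_hom, slide_hom, ← Functor.map_comp_assoc, E.equivAt_naturality, Functor.map_comp,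
    Category.assoc, Category.assoc]
  congr 1
  exact (τ.ψ g h).hom.naturality (E.functor.map f)

/-- Sliding `h` and then `l` differs from sliding `hl` by the cocycle.  The scalar does not
depend on `E`. -/
theorem Hom.slide_assoc {g s t : G} (h l : H) (e : g * h = s) (e' : s * l = t)
    (e'' : g * (h * l : H) = t) (N : W) :
    (τ.ρ g).map (E.functor.map ((ρ.ψ h l).hom.app N)) ≫ (E.slide (h * l) e'' N).hom =
      ((α.toFun g h l : kˣ) : k) •
        ((E.slide h e ((ρ.ρ l).obj N)).hom ≫ (E.slide l e' N).hom) := by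
  subst e e'
  have h1 := τ.ψ_assoc g h l (E.functor.obj N)
  have h2 := (τ.ψ g h).hom.naturality (E.equivAt l N).hom
  have h3 := congrArg (τ.ρ g).map (E.map_ψ_equivAt h l N)
  simp only [Functor.map_comp] at h3
  dsimp at h2
  rw [slide_hom, slide_hom]
  simp only [slide, Iso.trans_hom, Functor.mapIso_hom, Iso.app_hom, eqToIso.hom,
    Category.assoc]
  rw [reassoc_of% h3, ← reassoc_of% h2, ← Linear.comp_smul, ← Linear.comp_smul, ← h1]
  rfl

end Slide

/-! ### The functors of a projective 2-representation are equivalences -/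

section Equivalence

variable {k : Type u} [Field k] {Γ : Type v} [Group Γ] {α : NormalizedCocycle k Γ}
  {V : Type*} [Category* V] [Preadditive V] [Linear k V] (σ : ProjTwoRep α V)

/-- The isomorphism `ρ(h)ρ(g) ≅ id` for `h * g = 1`. -/
def compIsoId {h g : Γ} (e : h * g = 1) : σ.ρ g ⋙ σ.ρ h ≅ 𝟭 V :=
  σ.ψ h g ≪≫ eqToIso (congrArg σ.ρ e) ≪≫ σ.ψ₁

instance ρ_faithful (g : Γ) : (σ.ρ g).Faithful :=
  Functor.Faithful.of_comp_iso (σ.compIsoId (inv_mul_cancel g))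

instance ρ_full (g : Γ) : (σ.ρ g).Full :=
  Functor.Full.of_comp_faithful_iso (G := σ.ρ g⁻¹) (σ.compIsoId (inv_mul_cancel g))

end Equivalence

/-! ### Decompositions along cosets -/

section Decomposition

variable {k : Type u} [Field k] {G : Type v} [Group G] {α : NormalizedCocycle k G}
  {H : Subgroup G} {W : Type*} [Category* W] [Preadditive W] [Linear k W]
  {V : Type*} [Category* V] [Preadditive V] [Linear k V]

/-- A functorial decomposition `M ≅ ⨁_c σ(g_c) j(R_c M)` of the objects of `V`, indexed by the
cosets `c ∈ G/H` with representatives `g_c = c.out`, such that there are no nonzero morphisms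
between objects `σ(g) j(N)` that belong to different cosets. -/
structure CosetDecomposition [Fintype (G ⧸ H)] {ρ : ProjTwoRep (α.restrict H) W}
    {σ : ProjTwoRep α V} (j : Hom ρ (σ.restrict H)) where
  R : G ⧸ H → V ⥤ W
  ι : ∀ c M, (σ.ρ c.out).obj (j.functor.obj ((R c).obj M)) ⟶ M
  p : ∀ c M, M ⟶ (σ.ρ c.out).obj (j.functor.obj ((R c).obj M))
  ι_naturality : ∀ c {M M' : V} (f : M ⟶ M'),
    (σ.ρ c.out).map (j.functor.map ((R c).map f)) ≫ ι c M' = ι c M ≫ f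
  p_naturality : ∀ c {M M' : V} (f : M ⟶ M'),
    f ≫ p c M' = p c M ≫ (σ.ρ c.out).map (j.functor.map ((R c).map f))
  ι_p : ∀ c M, ι c M ≫ p c M = 𝟙 _
  sum_p_ι : ∀ M, ∑ c, p c M ≫ ι c M = 𝟙 M
  vanish : ∀ {g g' : G}, (g : G ⧸ H) ≠ (g' : G ⧸ H) → ∀ {N N' : W}
    (f : (σ.ρ g).obj (j.functor.obj N) ⟶ (σ.ρ g').obj (j.functor.obj N')), f = 0

namespace CosetDecomposition

theorem coset_out_ne {c d : G ⧸ H} (h : c ≠ d) : ((c.out : G) : G ⧸ H) ≠ ((d.out : G) : G ⧸ H) := by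
  rwa [QuotientGroup.out_eq', QuotientGroup.out_eq']

variable [Fintype (G ⧸ H)] {ρ : ProjTwoRep (α.restrict H) W}
  {σ : ProjTwoRep α V} {j : Hom ρ (σ.restrict H)}

/-- If there are no morphisms between different cosets, then decompositions of the individual
objects are automatically functorial. -/
theorem nonempty_of_objectwise [j.functor.Full] [j.functor.Faithful]
    (vanish : ∀ {g g' : G}, (g : G ⧸ H) ≠ (g' : G ⧸ H) → ∀ {N N' : W}
      (f : (σ.ρ g).obj (j.functor.obj N) ⟶ (σ.ρ g').obj (j.functor.obj N')), f = 0)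
    (dec : ∀ M : V, ∃ (N : G ⧸ H → W) (ι : ∀ c, (σ.ρ c.out).obj (j.functor.obj (N c)) ⟶ M)
      (p : ∀ c, M ⟶ (σ.ρ c.out).obj (j.functor.obj (N c))),
      (∀ c, ι c ≫ p c = 𝟙 _) ∧ ∑ c, p c ≫ ι c = 𝟙 M) :
    Nonempty (CosetDecomposition j) := by
  choose N ι p hιp hsum using dec
  -- Since the mixed terms vanish, every morphism is diagonal with respect to the decompositions.
  have hmap : ∀ c {M M' : V} (f : M ⟶ M'),
      ((ι M c ≫ f ≫ p M' c) ≫ ι M' c = ι M c ≫ f) ∧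
        (f ≫ p M' c = p M c ≫ ι M c ≫ f ≫ p M' c) := by
    intro c M M' f
    constructor
    · conv_rhs => rw [← Category.comp_id f, ← hsum M', Preadditive.comp_sum, Preadditive.comp_sum]
      rw [Finset.sum_eq_single c]
      · simp
      · intro d _ hd
        rw [← Category.assoc, ← Category.assoc, Category.assoc (ι M c),
          vanish (coset_out_ne hd.symm) (ι M c ≫ f ≫ p M' d), zero_comp]
      · simp
    · conv_lhs => rw [← Category.id_comp f, ← hsum M, Category.assoc, Preadditive.sum_comp]
      rw [Finset.sum_eq_single c]
      · simp
      · intro d _ hd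
        rw [Category.assoc, vanish (coset_out_ne hd) (ι M d ≫ f ≫ p M' c), comp_zero]
      · simp
  exact ⟨{
    R := fun c =>
      { obj := fun M => N M c
        map := fun {M M'} f => (j.functor ⋙ σ.ρ c.out).preimage (ι M c ≫ f ≫ p M' c)
        map_id := fun M => (j.functor ⋙ σ.ρ c.out).map_injective (by
          rw [Functor.map_preimage, Category.id_comp, hιp]
          exact ((j.functor ⋙ σ.ρ c.out).map_id _).symm)
        map_comp := fun {M M' M''} f f' => (j.functor ⋙ σ.ρ c.out).map_injective (by
          rw [Functor.map_comp, Functor.map_preimage, Functor.map_preimage,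
            Functor.map_preimage, ← Category.assoc (ι M c ≫ f ≫ p M' c), (hmap c f).1]
          simp) }
    ι := fun c M => ι M c
    p := fun c M => p M c
    ι_naturality := fun c {M M'} f => by
      refine Eq.trans ?_ (hmap c f).1
      exact congrArg (· ≫ ι M' c) ((j.functor ⋙ σ.ρ c.out).map_preimage _)
    p_naturality := fun c {M M'} f => by
      refine (hmap c f).2.trans ?_
      exact congrArg (p M c ≫ ·) ((j.functor ⋙ σ.ρ c.out).map_preimage _).symm
    ι_p := fun c M => hιp M c
    sum_p_ι := hsum
    vanish := vanish }⟩

variable {N : Type*} [Category* N] [Preadditive N]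

theorem map_R (D : CosetDecomposition j) (c : G ⧸ H) {M M' : V} (f : M ⟶ M') :
    (σ.ρ c.out).map (j.functor.map ((D.R c).map f)) = D.ι c M ≫ f ≫ D.p c M' := by
  rw [D.p_naturality, ← Category.assoc, D.ι_p, Category.id_comp]

/-- Two natural transformations of additive functors agree if they agree on all `σ(g) j(N)`. -/
theorem natTrans_ext (D : CosetDecomposition j) {S S' : V ⥤ N} [S'.Additive] {η η' : S ⟶ S'}
    (h : ∀ g A, η.app ((σ.ρ g).obj (j.functor.obj A)) = η'.app _) : η = η' := by
  ext M
  rw [← Category.comp_id (η.app M), ← Category.comp_id (η'.app M), ← S'.map_id,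
    ← D.sum_p_ι M, S'.map_sum, Preadditive.comp_sum, Preadditive.comp_sum]
  refine Finset.sum_congr rfl fun c _ => ?_
  rw [← η.naturality, ← η'.naturality, S.map_comp, Category.assoc, Category.assoc,
    η.naturality, η'.naturality, h]

/-- A family of morphisms `S(σ(g) j(N)) ⟶ S'(σ(g) j(N))` that is natural in `N` and compatible
with the isomorphisms `σ(g) j(ρ(h) N) ≅ σ(gh) j(N)` is natural with respect to all morphisms,
since these generate. -/
theorem family_naturality [j.functor.Full] (D : CosetDecomposition j) {S S' : V ⥤ N}
    [S.Additive] [S'.Additive]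
    (a : ∀ g A, S.obj ((σ.ρ g).obj (j.functor.obj A)) ⟶ S'.obj ((σ.ρ g).obj (j.functor.obj A)))
    (nat : ∀ g {A B} (u : A ⟶ B), S.map ((σ.ρ g).map (j.functor.map u)) ≫ a g B =
      a g A ≫ S'.map ((σ.ρ g).map (j.functor.map u)))
    (compat : ∀ {g s : G} (h : H) (e : g * h = s) (A : W),
      S.map (j.slide h e A).hom ≫ a s A =
        a g ((ρ.ρ h).obj A) ≫ S'.map (j.slide h e A).hom)
    {g g' : G} {A B : W} (f : (σ.ρ g).obj (j.functor.obj A) ⟶ (σ.ρ g').obj (j.functor.obj B)) :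
    S.map f ≫ a g' B = a g A ≫ S'.map f := by
  by_cases hg : (g : G ⧸ H) = (g' : G ⧸ H)
  · have e : g * (⟨g⁻¹ * g', QuotientGroup.eq.1 hg⟩ : H) = g' := mul_inv_cancel_left _ _
    obtain ⟨f', rfl⟩ : ∃ f', f = f' ≫ (j.slide _ e B).hom := ⟨f ≫ (j.slide _ e B).inv, by simp⟩
    obtain ⟨u, rfl⟩ := (j.functor ⋙ σ.ρ g).map_surjective f'
    dsimp only [Functor.comp_map]
    rw [S.map_comp, S'.map_comp, Category.assoc, compat, ← Category.assoc, nat, Category.assoc]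
  · rw [D.vanish hg f, S.map_zero, S'.map_zero, zero_comp, comp_zero]

/-- A natural transformation of additive functors on `V` may be defined on the objects
`σ(g) j(N)`. -/
theorem exists_natTrans [j.functor.Full] (D : CosetDecomposition j) {S S' : V ⥤ N}
    [S.Additive] [S'.Additive]
    (a : ∀ g A, S.obj ((σ.ρ g).obj (j.functor.obj A)) ⟶ S'.obj ((σ.ρ g).obj (j.functor.obj A)))
    (nat : ∀ g {A B} (u : A ⟶ B), S.map ((σ.ρ g).map (j.functor.map u)) ≫ a g B =
      a g A ≫ S'.map ((σ.ρ g).map (j.functor.map u)))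
    (compat : ∀ {g s : G} (h : H) (e : g * h = s) (A : W),
      S.map (j.slide h e A).hom ≫ a s A =
        a g ((ρ.ρ h).obj A) ≫ S'.map (j.slide h e A).hom) :
    ∃ η : S ⟶ S', ∀ g A, η.app ((σ.ρ g).obj (j.functor.obj A)) = a g A := by
  -- Split `M` along the cosets and apply the family to each summand.
  refine ⟨{ app := fun M => ∑ c, S.map (D.p c M) ≫ a c.out ((D.R c).obj M) ≫ S'.map (D.ι c M)
            naturality := fun M M' f => ?_ }, fun g A => ?_⟩
  · rw [Preadditive.comp_sum, Preadditive.sum_comp]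
    refine Finset.sum_congr rfl fun c _ => ?_
    rw [← Category.assoc, ← S.map_comp, D.p_naturality, S.map_comp, Category.assoc,
      reassoc_of% (nat c.out ((D.R c).map f)), ← S'.map_comp, D.ι_naturality]
    simp
  · simp only [← Category.assoc, D.family_naturality a nat compat]
    simp only [Category.assoc, ← S'.map_comp, ← Preadditive.comp_sum, ← S'.map_sum,
      D.sum_p_ι]
    simp

theorem exists_natIso [j.functor.Full] (D : CosetDecomposition j) {S S' : V ⥤ N}
    [S.Additive] [S'.Additive]
    (a : ∀ g A, S.obj ((σ.ρ g).obj (j.functor.obj A)) ≅ S'.obj ((σ.ρ g).obj (j.functor.obj A)))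
    (nat : ∀ g {A B} (u : A ⟶ B), S.map ((σ.ρ g).map (j.functor.map u)) ≫ (a g B).hom =
      (a g A).hom ≫ S'.map ((σ.ρ g).map (j.functor.map u)))
    (compat : ∀ {g s : G} (h : H) (e : g * h = s) (A : W),
      S.map (j.slide h e A).hom ≫ (a s A).hom =
        (a g ((ρ.ρ h).obj A)).hom ≫ S'.map (j.slide h e A).hom) :
    ∃ η : S ≅ S', ∀ g A, η.hom.app ((σ.ρ g).obj (j.functor.obj A)) = (a g A).hom := by
  obtain ⟨η, hη⟩ := D.exists_natTrans (fun g A => (a g A).hom) nat compat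
  obtain ⟨θ, hθ⟩ := D.exists_natTrans (fun g A => (a g A).inv)
    (fun g {A B} u => by rw [Iso.eq_inv_comp, ← Category.assoc, Iso.comp_inv_eq, nat])
    (fun h e A => by rw [Iso.eq_inv_comp, ← Category.assoc, Iso.comp_inv_eq, compat])
  refine ⟨⟨η, θ, D.natTrans_ext fun g A => ?_, D.natTrans_ext fun g A => ?_⟩, hη⟩
  · rw [NatTrans.comp_app, hη, hθ, Iso.hom_inv_id, NatTrans.id_app]
  · rw [NatTrans.comp_app, hη, hθ, Iso.inv_hom_id, NatTrans.id_app]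

end CosetDecomposition

end Decomposition
/-! ### 2-isomorphisms from natural isomorphisms -/

section TwoIso

variable {k : Type u} [Field k] {Γ : Type v} [Group Γ] {α : NormalizedCocycle k Γ}
  {V : Type*} [Category* V] [Preadditive V] [Linear k V]
  {N : Type*} [Category* N] [Preadditive N] [Linear k N]
  {σ : ProjTwoRep α V} {π : ProjTwoRep α N}

/-- The natural isomorphism underlying a 2-isomorphism. -/
def natIso {F F' : Hom σ π} (Φ : F ≅ F') : F.functor ≅ F'.functor where
  hom := Hom₂.nat Φ.hom
  inv := Hom₂.nat Φ.inv
  hom_inv_id := congrArg Hom₂.nat Φ.hom_inv_id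
  inv_hom_id := congrArg Hom₂.nat Φ.inv_hom_id

/-- A natural isomorphism that is compatible with the equivariance isomorphisms is a
2-isomorphism. -/
def isoOfNatIso {F F' : Hom σ π} (φ : F.functor ≅ F'.functor)
    (comm : ∀ (g : Γ) (M : V), (F.equiv g).hom.app M ≫ (π.ρ g).map (φ.hom.app M) =
      φ.hom.app ((σ.ρ g).obj M) ≫ (F'.equiv g).hom.app M) : F ≅ F' where
  hom := ⟨φ.hom, comm⟩
  inv := ⟨φ.inv, fun g M => by
    rw [← cancel_epi (φ.hom.app ((σ.ρ g).obj M)), ← reassoc_of% (comm g M), ← Functor.map_comp]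
    simp⟩
  hom_inv_id := Hom₂.ext φ.hom_inv_id
  inv_hom_id := Hom₂.ext φ.inv_hom_id

end TwoIso

/-! ### Frames -/

section Frame

variable {k : Type u} [Field k] {G : Type v} [Group G] {α : NormalizedCocycle k G}
  {H : Subgroup G} {W : Type*} [Category* W] [Preadditive W] [Linear k W]
  {V : Type*} [Category* V] [Preadditive V] [Linear k V]
  {N : Type*} [Category* N] [Preadditive N] [Linear k N]
  {ρ : ProjTwoRep (α.restrict H) W} {σ : ProjTwoRep α V} {π : ProjTwoRep α N}

/-- Sliding an element of the subgroup commutes with `ψ` up to the cocycle. -/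
theorem Hom.map_slide_ψ (E : Hom ρ (σ.restrict H)) (s : G) {g t : G} (h : H) (e : g * h = t)
    (e' : s * g * h = s * t) (A : W) :
    (σ.ρ s).map (E.slide h e A).hom ≫ (σ.ψ s t).hom.app (E.functor.obj A) =
      ((α.toFun s g h : kˣ) : k) •
        ((σ.ψ s g).hom.app (E.functor.obj ((ρ.ρ h).obj A)) ≫ (E.slide h e' A).hom) := by
  subst e
  have h1 := σ.ψ_assoc s g h (E.functor.obj A)
  have h2 := (σ.ψ s g).hom.naturality (E.equivAt h A).hom
  dsimp at h2
  rw [← cancel_mono (eqToHom (congrArg (fun x => (σ.ρ x).obj (E.functor.obj A)) e'.symm)),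
    slide_hom, Functor.map_comp]
  simp only [Category.assoc, h1, Linear.smul_comp, slide, Iso.trans_hom, Functor.mapIso_hom,
    Iso.app_hom, eqToIso.hom, eqToHom_trans, eqToHom_refl, Category.comp_id, Linear.comp_smul]
  rw [reassoc_of% h2]

/-- A frame of a functor `S : V ⥤ N` identifies `S(σ(g) j(A))` with `π(g) F(A)`, naturally in
`A` and compatibly with the subgroup.  Factorisations `F ≅ F̄ j` correspond to frames
of `F̄`. -/
structure Frame (j : Hom ρ (σ.restrict H)) (F : Hom ρ (π.restrict H)) (S : V ⥤ N) where
  θ : ∀ g A, S.obj ((σ.ρ g).obj (j.functor.obj A)) ≅ (π.ρ g).obj (F.functor.obj A)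
  naturality : ∀ g {A B : W} (u : A ⟶ B),
    S.map ((σ.ρ g).map (j.functor.map u)) ≫ (θ g B).hom =
      (θ g A).hom ≫ (π.ρ g).map (F.functor.map u)
  compat : ∀ {g s : G} (h : H) (e : g * h = s) (A : W),
    S.map (j.slide h e A).hom ≫ (θ s A).hom =
      (θ g ((ρ.ρ h).obj A)).hom ≫ (F.slide h e A).hom

namespace Frame

variable {j : Hom ρ (σ.restrict H)} {F : Hom ρ (π.restrict H)}

theorem map_eqToHom {S : V ⥤ N} (T : Frame j F S) {g g' : G} (e : g = g') (A : W) :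
    S.map (eqToHom (congrArg (fun x => (σ.ρ x).obj (j.functor.obj A)) e)) ≫ (T.θ g' A).hom =
      (T.θ g A).hom ≫ eqToHom (congrArg (fun x => (π.ρ x).obj (F.functor.obj A)) e) := by
  subst e
  simp

/-- The component at `A` of a 2-isomorphism `F ≅ F̄ j`. -/
def factorAt (F' : Hom σ π) (Φ : F ≅ j.comp (F'.restrict H)) (A : W) :
    F.functor.obj A ≅ F'.functor.obj (j.functor.obj A) :=
  (natIso Φ).app A

theorem factorAt_naturality (F' : Hom σ π) (Φ : F ≅ j.comp (F'.restrict H)) {A B : W}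
    (u : A ⟶ B) :
    F.functor.map u ≫ (factorAt F' Φ B).hom =
      (factorAt F' Φ A).hom ≫ F'.functor.map (j.functor.map u) :=
  (natIso Φ).hom.naturality u

theorem factorAt_comm (F' : Hom σ π) (Φ : F ≅ j.comp (F'.restrict H)) (h : H) (A : W) :
    (F.equivAt h A).hom ≫ (π.ρ h).map (factorAt F' Φ A).hom =
      (factorAt F' Φ ((ρ.ρ h).obj A)).hom ≫ F'.functor.map (j.equivAt h A).hom ≫
        (F'.equiv h).hom.app (j.functor.obj A) :=
  Hom₂.comm Φ.hom h A

/-- The frame of `F̄` given by a 2-isomorphism `F ≅ F̄ j`. -/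
def ofFactorization (F' : Hom σ π) (Φ : F ≅ j.comp (F'.restrict H)) :
    Frame j F F'.functor where
  θ g A := (F'.equiv g).app (j.functor.obj A) ≪≫ (π.ρ g).mapIso (factorAt F' Φ A).symm
  naturality g A B u := by
    have h1 := (F'.equiv g).hom.naturality (j.functor.map u)
    dsimp at h1 ⊢
    rw [reassoc_of% h1, Category.assoc, ← Functor.map_comp, ← Functor.map_comp]
    congr 2
    rw [Iso.eq_inv_comp, ← Category.assoc, Iso.comp_inv_eq, factorAt_naturality]
  compat {g s} h e A := by
    subst e
    have h1 := F'.map_ψ g h (j.functor.obj A)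
    have h2 := (F'.equiv g).hom.naturality (j.equivAt h A).hom
    have h3 := (π.ψ g h).hom.naturality (factorAt F' Φ A).inv
    have h4 : F'.functor.map (j.equivAt h A).hom ≫ (F'.equiv h).hom.app (j.functor.obj A) ≫
        (π.ρ h).map (factorAt F' Φ A).inv =
          (factorAt F' Φ ((ρ.ρ h).obj A)).inv ≫ (F.equivAt h A).hom := by
      rw [Iso.eq_inv_comp, ← reassoc_of% (factorAt_comm F' Φ h A), ← Functor.map_comp]
      simp
    dsimp at h2 h3 ⊢
    rw [Hom.slide_hom, Hom.slide_hom, Functor.map_comp]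
    simp only [Category.assoc]
    rw [reassoc_of% h1, reassoc_of% h2, ← h3, ← Functor.map_comp_assoc, ← Functor.map_comp_assoc,
      ← Functor.map_comp_assoc, ← h4]
    simp

end Frame
end Frame
/-! ### Framed functors are 1-morphisms -/

section FrameHom

variable {k : Type u} [Field k] {G : Type v} [Group G] {α : NormalizedCocycle k G}
  {H : Subgroup G} [Fintype (G ⧸ H)] {W : Type*} [Category* W] [Preadditive W] [Linear k W]
  {V : Type*} [Category* V] [Preadditive V] [Linear k V]
  {N : Type*} [Category* N] [Preadditive N] [Linear k N]
  {ρ : ProjTwoRep (α.restrict H) W} {σ : ProjTwoRep α V} {π : ProjTwoRep α N}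
  {j : Hom ρ (σ.restrict H)} {F : Hom ρ (π.restrict H)}

namespace Frame

/-- A framed functor carries equivariance isomorphisms; they are determined by the frame. -/
theorem exists_equivariance [j.functor.Full] (D : CosetDecomposition j) {S : V ⥤ N}
    [S.Additive] [S.Linear k] (T : Frame j F S) (s : G) :
    ∃ e : σ.ρ s ⋙ S ≅ S ⋙ π.ρ s, ∀ g A,
      e.hom.app ((σ.ρ g).obj (j.functor.obj A)) ≫ (π.ρ s).map (T.θ g A).hom ≫
          (π.ψ s g).hom.app (F.functor.obj A) =
        S.map ((σ.ψ s g).hom.app (j.functor.obj A)) ≫ (T.θ (s * g) A).hom := by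
  -- On `σ(g) j(A)` both functors are identified with `π(sg) F(A)`.
  obtain ⟨e, he⟩ := D.exists_natIso (S := σ.ρ s ⋙ S) (S' := S ⋙ π.ρ s)
    (fun g A => S.mapIso ((σ.ψ s g).app (j.functor.obj A)) ≪≫ T.θ (s * g) A ≪≫
      ((π.ψ s g).app (F.functor.obj A)).symm ≪≫ (π.ρ s).mapIso (T.θ g A).symm)
    (fun g A B u => by
      have h1 := (σ.ψ s g).hom.naturality (j.functor.map u)
      have h2 := (π.ψ s g).inv.naturality (F.functor.map u)
      have h3 := T.naturality g u
      rw [← Iso.eq_comp_inv, Category.assoc, ← Iso.inv_comp_eq] at h3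
      dsimp at h1 h2 ⊢
      simp only [Category.assoc]
      rw [← S.map_comp_assoc, h1, S.map_comp_assoc, reassoc_of% (T.naturality (s * g) u),
        reassoc_of% h2, ← Functor.map_comp, ← Functor.map_comp, h3])
    (fun {g t} h e A => by
      have e' : s * g * h = s * t := by rw [← e, mul_assoc]
      have h1 := j.map_slide_ψ s h e e' A
      have h2 := F.map_slide_ψ s h e e' A
      have h3 := T.compat h e A
      rw [← Iso.eq_comp_inv, Category.assoc, ← Iso.inv_comp_eq] at h3
      dsimp at h1 h2 ⊢
      simp only [Category.assoc]
      rw [← S.map_comp_assoc, h1, Functor.map_smul, Linear.smul_comp, S.map_comp_assoc,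
        reassoc_of% (T.compat h e' A), ← Functor.map_comp, h3, Functor.map_comp,
        ← Linear.comp_smul, ← Linear.comp_smul]
      congr 2
      rw [← Category.assoc, ← Category.assoc, ← Linear.smul_comp]
      congr 1
      rw [← cancel_mono ((π.ψ s t).hom.app (F.functor.obj A))]
      simp [h2])
  refine ⟨e, fun g A => ?_⟩
  rw [he]
  simp [← Functor.map_comp_assoc]

/-- The equivariance isomorphisms of a framed functor. -/
noncomputable def equivariance [j.functor.Full] (D : CosetDecomposition j) {S : V ⥤ N}
    [S.Additive] [S.Linear k] (T : Frame j F S) (s : G) : σ.ρ s ⋙ S ≅ S ⋙ π.ρ s :=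
  (T.exists_equivariance D s).choose

theorem equivariance_spec [j.functor.Full] (D : CosetDecomposition j) {S : V ⥤ N}
    [S.Additive] [S.Linear k] (T : Frame j F S) (s g : G) (A : W) :
    (T.equivariance D s).hom.app ((σ.ρ g).obj (j.functor.obj A)) ≫
        (π.ρ s).map (T.θ g A).hom ≫ (π.ψ s g).hom.app (F.functor.obj A) =
      S.map ((σ.ψ s g).hom.app (j.functor.obj A)) ≫ (T.θ (s * g) A).hom :=
  (T.exists_equivariance D s).choose_spec g A

theorem equivariance_ψ [j.functor.Full] (D : CosetDecomposition j) {S : V ⥤ N}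
    [S.Additive] [S.Linear k] (T : Frame j F S) (s t : G) (M : V) :
    S.map ((σ.ψ s t).hom.app M) ≫ (T.equivariance D (s * t)).hom.app M =
      (T.equivariance D s).hom.app ((σ.ρ t).obj M) ≫
        (π.ρ s).map ((T.equivariance D t).hom.app M) ≫ (π.ψ s t).hom.app (S.obj M) := by
  suffices h : Functor.whiskerRight (σ.ψ s t).hom S ≫ (T.equivariance D (s * t)).hom =
      (show (σ.ρ t ⋙ σ.ρ s) ⋙ S ⟶ S ⋙ π.ρ (s * t) from
        Functor.whiskerLeft (σ.ρ t) (T.equivariance D s).hom ≫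
          Functor.whiskerRight (T.equivariance D t).hom (π.ρ s) ≫
            Functor.whiskerLeft S (π.ψ s t).hom) from NatTrans.congr_app h M
  refine D.natTrans_ext fun g A => ?_
  change S.map ((σ.ψ s t).hom.app _) ≫ (T.equivariance D (s * t)).hom.app _ =
    (T.equivariance D s).hom.app ((σ.ρ t).obj _) ≫
        (π.ρ s).map ((T.equivariance D t).hom.app _) ≫ (π.ψ s t).hom.app (S.obj _)
  have h1 := σ.ψ_assoc s t g (j.functor.obj A)
  have h2 := π.ψ_assoc s t g (F.functor.obj A)
  have h3 := (π.ψ s t).hom.naturality (T.θ g A).hom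
  have h4 := (T.equivariance D s).hom.naturality ((σ.ψ t g).hom.app (j.functor.obj A))
  have h5 := T.map_eqToHom (mul_assoc s t g).symm A
  have h6 := congrArg (π.ρ s).map (T.equivariance_spec D t g A)
  simp only [Functor.map_comp] at h6
  dsimp at h3 h4
  -- Both sides agree after identifying the target with `π((st)g) F(A)` and scaling by `α`.
  rw [← cancel_mono ((π.ρ (s * t)).map (T.θ g A).hom ≫
    (π.ψ (s * t) g).hom.app (F.functor.obj A))]
  refine (Units.isUnit (α.toFun s t g)).smul_left_cancel.1 ?_
  rw [← Linear.comp_smul] at h2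
  rw [Category.assoc, T.equivariance_spec D (s * t) g A]
  simp only [Category.assoc, ← Linear.comp_smul]
  rw [← reassoc_of% h3, ← h2, reassoc_of% h6, ← reassoc_of% h4,
    reassoc_of% (T.equivariance_spec D s (t * g) A),
    ← h5, ← S.map_comp_assoc, ← S.map_comp_assoc, ← S.map_comp_assoc, Category.assoc, h1]
  simp only [S.map_smul, S.map_comp, Linear.smul_comp, Linear.comp_smul, Category.assoc]

theorem equivariance_ψ₁ [j.functor.Full] (D : CosetDecomposition j) {S : V ⥤ N}
    [S.Additive] [S.Linear k] (T : Frame j F S) (M : V) :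
    S.map (σ.ψ₁.hom.app M) = (T.equivariance D 1).hom.app M ≫ π.ψ₁.hom.app (S.obj M) := by
  suffices h : Functor.whiskerRight σ.ψ₁.hom S =
      (show σ.ρ 1 ⋙ S ⟶ S from
        (T.equivariance D 1).hom ≫ Functor.whiskerLeft S π.ψ₁.hom) from NatTrans.congr_app h M
  refine D.natTrans_ext fun g A => ?_
  change S.map (σ.ψ₁.hom.app _) = (T.equivariance D 1).hom.app _ ≫ π.ψ₁.hom.app (S.obj _)
  have h1 := π.ψ₁.hom.naturality (T.θ g A).hom
  have h2 := T.map_eqToHom (one_mul g) A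
  dsimp at h1
  rw [← σ.ψ_one_left, ← cancel_mono (T.θ g A).hom, S.map_comp, Category.assoc, h2,
    ← reassoc_of% (T.equivariance_spec D 1 g A), Category.assoc, ← h1, ← π.ψ_one_left]

/-- A framed `k`-linear functor underlies a 1-morphism of projective 2-representations. -/
noncomputable def toHom [j.functor.Full] (D : CosetDecomposition j) {S : V ⥤ N}
    [S.Additive] [S.Linear k] (T : Frame j F S) : Hom σ π where
  functor := S
  equiv := T.equivariance D
  map_ψ := T.equivariance_ψ D
  map_ψ₁ := T.equivariance_ψ₁ D

end Frame
end FrameHom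
/-! ### The extension of a 1-morphism -/

section FrameExistence

variable {k : Type u} [Field k] {G : Type v} [Group G] {α : NormalizedCocycle k G}
  {H : Subgroup G} {W : Type*} [Category* W] [Preadditive W] [Linear k W]
  {V : Type*} [Category* V] [Preadditive V] [Linear k V]
  {N : Type*} [Category* N] [Preadditive N] [Linear k N]
  {ρ : ProjTwoRep (α.restrict H) W} {σ : ProjTwoRep α V} {π : ProjTwoRep α N}
  {j : Hom ρ (σ.restrict H)} 

namespace CosetDecomposition

theorem functor_map_injective [j.functor.Faithful] (g : G) {A B : W} {u u' : A ⟶ B}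
    (h : (σ.ρ g).map (j.functor.map u) = (σ.ρ g).map (j.functor.map u')) : u = u' :=
  (j.functor ⋙ σ.ρ g).map_injective h

variable [Fintype (G ⧸ H)]

theorem R_map_add [j.functor.Faithful] (D : CosetDecomposition j) (c : G ⧸ H) {M M' : V}
    (f f' : M ⟶ M') : (D.R c).map (f + f') = (D.R c).map f + (D.R c).map f' :=
  functor_map_injective (j := j) c.out (by
    rw [j.functor.map_add, (σ.ρ c.out).map_add, D.map_R, D.map_R, D.map_R, Preadditive.add_comp,
      Preadditive.comp_add])

theorem R_map_smul [j.functor.Faithful] (D : CosetDecomposition j) (c : G ⧸ H) {M M' : V}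
    (a : k) (f : M ⟶ M') : (D.R c).map (a • f) = a • (D.R c).map f :=
  functor_map_injective (j := j) c.out (by
    rw [j.functor.map_smul, (σ.ρ c.out).map_smul, D.map_R, D.map_R, Linear.smul_comp,
      Linear.comp_smul])

theorem p_ι_of_coset (D : CosetDecomposition j) {g : G} {c : G ⧸ H} (hc : (g : G ⧸ H) = c)
    (A : W) : D.p c ((σ.ρ g).obj (j.functor.obj A)) ≫ D.ι c _ = 𝟙 _ := by
  rw [← D.sum_p_ι]
  symm
  refine Finset.sum_eq_single_of_mem c (Finset.mem_univ c) ?_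
  intro d _ hd
  have hne : (g : G ⧸ H) ≠ ((d.out : G) : G ⧸ H) := by
    rw [QuotientGroup.out_eq', hc]
    exact hd.symm
  rw [D.vanish hne (D.p d _), zero_comp]

theorem p_of_coset_ne (D : CosetDecomposition j) {g : G} {c : G ⧸ H} (hc : (g : G ⧸ H) ≠ c)
    (A : W) : D.p c ((σ.ρ g).obj (j.functor.obj A)) = 0 := by
  have hne : (g : G ⧸ H) ≠ ((c.out : G) : G ⧸ H) := by
    rwa [QuotientGroup.out_eq']
  exact D.vanish hne _

/-- The isomorphism `R_c(σ(g) j(A)) ≅ ρ(h) A` for `g = g_c h`. -/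
noncomputable def orbitIso [j.functor.Full] [j.functor.Faithful] (D : CosetDecomposition j)
    {g : G} {c : G ⧸ H} (h : H) (e : c.out * h = g) (A : W) :
    (D.R c).obj ((σ.ρ g).obj (j.functor.obj A)) ≅ (ρ.ρ h).obj A :=
  (j.functor ⋙ σ.ρ c.out).preimageIso
    ((show (σ.ρ c.out).obj (j.functor.obj ((D.R c).obj ((σ.ρ g).obj (j.functor.obj A)))) ≅
        (σ.ρ g).obj (j.functor.obj A) from
      ⟨D.ι c _, D.p c _, D.ι_p c _, D.p_ι_of_coset (by
        rw [← e, QuotientGroup.mk_mul_of_mem _ h.2, QuotientGroup.out_eq']) A⟩) ≪≫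
      (j.slide h e A).symm)

theorem map_orbitIso [j.functor.Full] [j.functor.Faithful] (D : CosetDecomposition j)
    {g : G} {c : G ⧸ H} (h : H) (e : c.out * h = g) (A : W) :
    (σ.ρ c.out).map (j.functor.map (D.orbitIso h e A).hom) = D.ι c _ ≫ (j.slide h e A).inv :=
  (j.functor ⋙ σ.ρ c.out).map_preimage _

theorem orbitIso_naturality [j.functor.Full] [j.functor.Faithful] (D : CosetDecomposition j)
    {g : G} {c : G ⧸ H} (h : H) (e : c.out * h = g) {A B : W} (u : A ⟶ B) :
    (D.R c).map ((σ.ρ g).map (j.functor.map u)) ≫ (D.orbitIso h e B).hom =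
      (D.orbitIso h e A).hom ≫ (ρ.ρ h).map u :=
  functor_map_injective (j := j) c.out (by
    simp only [Functor.map_comp]
    rw [map_orbitIso, map_orbitIso, ← Category.assoc, D.ι_naturality, Category.assoc,
      Category.assoc]
    congr 1
    rw [Iso.eq_inv_comp, ← Category.assoc, Iso.comp_inv_eq, j.slide_naturality])

/-- Sliding `l` on `σ(g) j(A)` corresponds under `orbitIso` to `ψ_{h,l}`, up to the cocycle. -/
theorem orbitIso_slide [j.functor.Full] [j.functor.Faithful] (D : CosetDecomposition j)
    {g s : G} {c : G ⧸ H} (h l : H) (e : c.out * h = g) (e' : g * l = s)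
    (e'' : c.out * (h * l : H) = s) (A : W) :
    ((α.toFun c.out h l : kˣ) : k) • ((D.R c).map (j.slide l e' A).hom ≫
        (D.orbitIso (h * l) e'' A).hom) =
      (D.orbitIso h e ((ρ.ρ l).obj A)).hom ≫ (ρ.ψ h l).hom.app A :=
  functor_map_injective (j := j) c.out (by
    simp only [Functor.map_comp, Functor.map_smul]
    rw [map_orbitIso, map_orbitIso, ← Category.assoc, D.ι_naturality, Category.assoc,
      Category.assoc, ← Linear.comp_smul]
    congr 1
    rw [Iso.eq_inv_comp, Linear.comp_smul, ← Category.assoc, ← Linear.smul_comp, Iso.comp_inv_eq,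
      j.slide_assoc h l e e'])

variable [HasFiniteBiproducts N] (π) (F : Hom ρ (π.restrict H))

/-- The functor `M ↦ ⨁_c π(g_c) F(R_c M)` that extends `F`. -/
noncomputable def extension (D : CosetDecomposition j) : V ⥤ N where
  obj M := ⨁ fun c => (π.ρ c.out).obj (F.functor.obj ((D.R c).obj M))
  map f := biproduct.map fun c => (π.ρ c.out).map (F.functor.map ((D.R c).map f))
  map_id M := by
    ext
    simp
  map_comp f f' := by
    ext
    simp

/-- The projection of the extension onto a summand. -/
noncomputable def extensionπ (D : CosetDecomposition j) (M : V) (c : G ⧸ H) :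
    (D.extension π F).obj M ⟶ (π.ρ c.out).obj (F.functor.obj ((D.R c).obj M)) :=
  biproduct.π (fun c : G ⧸ H => (π.ρ c.out).obj (F.functor.obj ((D.R c).obj M))) c

/-- The inclusion of a summand into the extension. -/
noncomputable def extensionι (D : CosetDecomposition j) (M : V) (c : G ⧸ H) :
    (π.ρ c.out).obj (F.functor.obj ((D.R c).obj M)) ⟶ (D.extension π F).obj M :=
  biproduct.ι (fun c : G ⧸ H => (π.ρ c.out).obj (F.functor.obj ((D.R c).obj M))) c

theorem extensionι_π (D : CosetDecomposition j) (M : V) (c : G ⧸ H) :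
    D.extensionι π F M c ≫ D.extensionπ π F M c = 𝟙 _ :=
  biproduct.ι_π_self _ c

theorem extension_hom_ext (D : CosetDecomposition j) {Y : N} {M : V}
    {f f' : Y ⟶ (D.extension π F).obj M}
    (h : ∀ c, f ≫ D.extensionπ π F M c = f' ≫ D.extensionπ π F M c) : f = f' :=
  biproduct.hom_ext _ _ h

theorem extension_map_π (D : CosetDecomposition j) {M M' : V} (f : M ⟶ M') (c : G ⧸ H) :
    (D.extension π F).map f ≫ D.extensionπ π F M' c =
      D.extensionπ π F M c ≫ (π.ρ c.out).map (F.functor.map ((D.R c).map f)) :=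
  biproduct.map_π (fun c : G ⧸ H => (π.ρ c.out).map (F.functor.map ((D.R c).map f))) c

instance extension_additive [j.functor.Faithful] (D : CosetDecomposition j) :
    (D.extension π F).Additive where
  map_add := D.extension_hom_ext π F fun c => by
    rw [Preadditive.add_comp]
    simp only [extension_map_π, R_map_add, Functor.map_add, Preadditive.comp_add]

instance extension_linear [j.functor.Faithful] (D : CosetDecomposition j) :
    (D.extension π F).Linear k where
  map_smul _ _ := D.extension_hom_ext π F fun c => by
    rw [Linear.smul_comp]
    simp only [extension_map_π, R_map_smul, Functor.map_smul, Linear.comp_smul]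

/-- A summand of the extension vanishes on `σ(g) j(A)` unless it belongs to the coset of `g`. -/
theorem extensionπ_of_coset_ne [j.functor.Faithful] (D : CosetDecomposition j) {g : G}
    {c : G ⧸ H} (hc : (g : G ⧸ H) ≠ c) (A : W) :
    D.extensionπ π F ((σ.ρ g).obj (j.functor.obj A)) c = 0 := by
  have h0 : 𝟙 ((D.R c).obj ((σ.ρ g).obj (j.functor.obj A))) = 0 :=
    functor_map_injective (j := j) c.out (by
      rw [j.functor.map_id, (σ.ρ c.out).map_id, ← D.ι_p c, D.p_of_coset_ne hc, comp_zero,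
        Functor.map_zero, Functor.map_zero])
  have h1 := D.extension_map_π π F (𝟙 ((σ.ρ g).obj (j.functor.obj A))) c
  rw [(D.R c).map_id, h0, Functor.map_zero, Functor.map_zero, comp_zero,
    (D.extension π F).map_id, Category.id_comp] at h1
  exact h1

/-- On `σ(g) j(A)` only the summand of the coset `c = gH` of the extension is nonzero. -/
noncomputable def extensionIso [j.functor.Full] [j.functor.Faithful] (D : CosetDecomposition j)
    {g : G} {c : G ⧸ H} (h : H) (e : c.out * h = g) (A : W) :
    (D.extension π F).obj ((σ.ρ g).obj (j.functor.obj A)) ≅ (π.ρ g).obj (F.functor.obj A) :=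
  { hom := D.extensionπ π F _ c
    inv := D.extensionι π F _ c
    hom_inv_id := D.extension_hom_ext π F fun d => by
      by_cases hd : c = d
      · subst hd
        rw [Category.assoc, extensionι_π, Category.comp_id, Category.id_comp]
      · have hne : (g : G ⧸ H) ≠ d := by
          rwa [← e, QuotientGroup.mk_mul_of_mem _ h.2, QuotientGroup.out_eq']
        rw [D.extensionπ_of_coset_ne π F hne, comp_zero, comp_zero]
    inv_hom_id := D.extensionι_π π F _ c } ≪≫
  (π.ρ c.out).mapIso (F.functor.mapIso (D.orbitIso h e A)) ≪≫ F.slide h e A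

theorem extensionIso_hom [j.functor.Full] [j.functor.Faithful] (D : CosetDecomposition j)
    {g : G} {c : G ⧸ H} (h : H) (e : c.out * h = g) (A : W) :
    (D.extensionIso π F h e A).hom =
      D.extensionπ π F _ c ≫ (π.ρ c.out).map (F.functor.map (D.orbitIso h e A).hom) ≫
        (F.slide h e A).hom :=
  rfl

/-- The coset `c` and the element `h` in `extensionIso` are determined by `g`. -/
theorem extensionIso_congr [j.functor.Full] [j.functor.Faithful] (D : CosetDecomposition j)
    {g : G} {c c' : G ⧸ H} (h h' : H) (e : c.out * h = g) (e' : c'.out * h' = g) (A : W) :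
    D.extensionIso π F h e A = D.extensionIso π F h' e' A := by
  obtain rfl : c = c' := by
    rw [← QuotientGroup.out_eq' c, ← QuotientGroup.out_eq' c',
      ← QuotientGroup.mk_mul_of_mem _ h.2, ← QuotientGroup.mk_mul_of_mem c'.out h'.2, e, e']
  obtain rfl : h = h' := Subtype.ext (mul_left_cancel (e.trans e'.symm))
  rfl

/-- The cocycle in `orbitIso_slide` cancels against the one in `slide_assoc` for `F`. -/
theorem extensionIso_compat [j.functor.Full] [j.functor.Faithful] (D : CosetDecomposition j)
    {g s : G} {c : G ⧸ H} (h l : H) (e : c.out * h = g) (e' : g * l = s) (A : W) :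
    (D.extension π F).map (j.slide l e' A).hom ≫
        (D.extensionIso π F (c := c) (h * l)
          (by rw [← e', ← e, Subgroup.coe_mul, mul_assoc]) A).hom =
      (D.extensionIso π F h e ((ρ.ρ l).obj A)).hom ≫ (F.slide l e' A).hom := by
  have e'' : c.out * (h * l : H) = s := by rw [← e', ← e, Subgroup.coe_mul, mul_assoc]
  refine (Units.isUnit (α.toFun c.out h l)).smul_left_cancel.1 ?_
  rw [extensionIso_hom, extensionIso_hom, reassoc_of% (D.extension_map_π π F)]
  simp only [Category.assoc]
  rw [← Functor.map_comp_assoc, ← Functor.map_comp, ← Linear.comp_smul, ← Linear.smul_comp,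
    ← Functor.map_smul, ← Functor.map_smul, D.orbitIso_slide h l e e' e'', Functor.map_comp,
    Functor.map_comp_assoc, F.slide_assoc h l e e' e'']
  simp only [Linear.comp_smul]

/-- The extension of `F` is framed. -/
noncomputable def extensionFrame [j.functor.Full] [j.functor.Faithful]
    (D : CosetDecomposition j) : Frame j F (D.extension π F) where
  θ g A := D.extensionIso π F (c := (g : G ⧸ H))
    ⟨_, QuotientGroup.eq.1 (QuotientGroup.out_eq' (g : G ⧸ H))⟩ (mul_inv_cancel_left _ _) A
  naturality g A B u := by
    rw [extensionIso_hom, extensionIso_hom, reassoc_of% (D.extension_map_π π F)]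
    simp only [Category.assoc]
    rw [← F.slide_naturality, ← Functor.map_comp_assoc, ← Functor.map_comp,
      D.orbitIso_naturality, Functor.map_comp, Functor.map_comp_assoc]
  compat l e A := by
    rw [← D.extensionIso_compat π F _ l (mul_inv_cancel_left _ _) e A]
    congr 2
    exact D.extensionIso_congr π F _ _ _ _ A

end CosetDecomposition
end FrameExistence
/-! ### The universal property of a decomposition along cosets -/

section UniversalProperty

variable {k : Type u} [Field k] {G : Type v} [Group G] {α : NormalizedCocycle k G}
  {H : Subgroup G} {W : Type*} [Category* W] [Preadditive W] [Linear k W]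
  {V : Type*} [Category* V] [Preadditive V] [Linear k V]
  {N : Type*} [Category* N] [Preadditive N] [Linear k N]
  {ρ : ProjTwoRep (α.restrict H) W} {σ : ProjTwoRep α V} {π : ProjTwoRep α N}
  {j : Hom ρ (σ.restrict H)} {F : Hom ρ (π.restrict H)}

/-- For `g = 1` sliding reduces to the equivariance isomorphism. -/
theorem Hom.slide_one (E : Hom ρ (σ.restrict H)) (h : H) (A : W) :
    (E.slide (g := 1) h (one_mul (h : G)) A).hom =
      σ.ψ₁.hom.app (E.functor.obj ((ρ.ρ h).obj A)) ≫ (E.equivAt h A).hom := by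
  have h1 := σ.ψ₁.hom.naturality (E.equivAt h A).hom
  dsimp at h1
  rw [← h1, ← σ.ψ_one_left]
  rfl

namespace Frame

/-- The equivariance isomorphisms on `j(A)` itself, obtained from `σ(1) j(A) ≅ j(A)`. -/
theorem equivariance_app [Fintype (G ⧸ H)] [j.functor.Full] (D : CosetDecomposition j)
    {S : V ⥤ N} [S.Additive] [S.Linear k] (T : Frame j F S) (g : G) (A : W) :
    (T.equivariance D g).hom.app (j.functor.obj A) = (T.θ g A).hom ≫
      (π.ρ g).map (π.ψ₁.inv.app (F.functor.obj A) ≫ (T.θ 1 A).inv ≫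
        S.map (σ.ψ₁.hom.app (j.functor.obj A))) := by
  have h1 := (T.equivariance D g).hom.naturality (σ.ψ₁.hom.app (j.functor.obj A))
  have h2 := congrArg (· ≫ eqToHom (congrArg (fun x => (π.ρ x).obj (F.functor.obj A))
    (mul_one g))) (T.equivariance_spec D g 1 A)
  dsimp at h1 h2
  simp only [Category.assoc] at h2
  rw [π.ψ_one_right, ← T.map_eqToHom (mul_one g), ← S.map_comp_assoc, σ.ψ_one_right,
    ← Functor.map_comp] at h2
  rw [← cancel_epi (S.map ((σ.ρ g).map (σ.ψ₁.hom.app (j.functor.obj A)))), h1, ← reassoc_of% h2,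
    ← Functor.map_comp]
  simp

/-- The 2-isomorphism `F ≅ F̄ j` given by a frame of `F̄`. -/
theorem nonempty_factorization [Fintype (G ⧸ H)] [j.functor.Full] (D : CosetDecomposition j)
    {S : V ⥤ N} [S.Additive] [S.Linear k] (T : Frame j F S) :
    Nonempty (F ≅ j.comp ((T.toHom D).restrict H)) := by
  refine ⟨isoOfNatIso (NatIso.ofComponents
    (fun A => (π.ψ₁.app (F.functor.obj A)).symm ≪≫ (T.θ 1 A).symm ≪≫
      S.mapIso (σ.ψ₁.app (j.functor.obj A))) ?_) ?_⟩
  · intro A B u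
    have h1 := π.ψ₁.inv.naturality (F.functor.map u)
    have h2 := σ.ψ₁.hom.naturality (j.functor.map u)
    have h3 := T.naturality 1 u
    rw [← Iso.eq_comp_inv, Category.assoc, ← Iso.inv_comp_eq] at h3
    change F.functor.map u ≫ π.ψ₁.inv.app _ ≫ (T.θ 1 B).inv ≫ S.map (σ.ψ₁.hom.app _) =
      (π.ψ₁.inv.app _ ≫ (T.θ 1 A).inv ≫ S.map (σ.ψ₁.hom.app _)) ≫
        S.map (j.functor.map u)
    dsimp at h1 h2
    rw [reassoc_of% h1, ← reassoc_of% h3, ← S.map_comp, h2]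
    simp
  · intro h A
    change (F.equivAt h A).hom ≫ (π.ρ h).map
        (π.ψ₁.inv.app _ ≫ (T.θ 1 A).inv ≫ S.map (σ.ψ₁.hom.app (j.functor.obj A))) =
      (π.ψ₁.inv.app _ ≫ (T.θ 1 ((ρ.ρ h).obj A)).inv ≫
        S.map (σ.ψ₁.hom.app (j.functor.obj ((ρ.ρ h).obj A)))) ≫
          S.map (j.equivAt h A).hom ≫ (T.equivariance D h).hom.app (j.functor.obj A)
    have h1 := T.compat h (one_mul (h : G)) A
    rw [j.slide_one, F.slide_one, S.map_comp, Category.assoc] at h1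
    rw [T.equivariance_app D, Category.assoc, Category.assoc, reassoc_of% h1]
    simp

/-- The frame of a factorisation determines the equivariance isomorphisms of `F̄`. -/
theorem ofFactorization_spec (F' : Hom σ π) (Φ : F ≅ j.comp (F'.restrict H)) (s g : G) (A : W) :
    (F'.equiv s).hom.app ((σ.ρ g).obj (j.functor.obj A)) ≫
        (π.ρ s).map ((ofFactorization F' Φ).θ g A).hom ≫ (π.ψ s g).hom.app (F.functor.obj A) =
      F'.functor.map ((σ.ψ s g).hom.app (j.functor.obj A)) ≫
        ((ofFactorization F' Φ).θ (s * g) A).hom := by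
  have h1 := F'.map_ψ s g (j.functor.obj A)
  have h2 := (π.ψ s g).hom.naturality (factorAt F' Φ A).inv
  dsimp [ofFactorization] at h1 h2 ⊢
  rw [reassoc_of% h1, Functor.map_comp, Category.assoc, h2]

/-- The frame of a factorisation in degree `1` is the factorisation. -/
theorem ofFactorization_one (F' : Hom σ π) (Φ : F ≅ j.comp (F'.restrict H)) (A : W) :
    ((ofFactorization F' Φ).θ 1 A).hom ≫ π.ψ₁.hom.app (F.functor.obj A) =
      F'.functor.map (σ.ψ₁.hom.app (j.functor.obj A)) ≫ (factorAt F' Φ A).inv := by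
  have h1 := F'.map_ψ₁ (j.functor.obj A)
  have h2 := π.ψ₁.hom.naturality (factorAt F' Φ A).inv
  dsimp [ofFactorization] at h1 h2 ⊢
  rw [Category.assoc, h2, h1, Category.assoc]

end Frame

theorem factorAt_whisker {F₁ F₂ : Hom σ π} (Φ₁ : F ≅ j.comp (F₁.restrict H))
    (Φ₂ : F ≅ j.comp (F₂.restrict H)) (η : F₁ ⟶ F₂) :
    Φ₁.hom ≫ whisker j (restrictHom₂ H η) = Φ₂.hom ↔
      ∀ A, (Frame.factorAt F₁ Φ₁ A).hom ≫ (Hom₂.nat η).app (j.functor.obj A) =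
        (Frame.factorAt F₂ Φ₂ A).hom := by
  constructor
  · intro h A
    exact NatTrans.congr_app (congrArg Hom₂.nat h) A
  · intro h
    exact Hom₂.ext (NatTrans.ext (funext h))

namespace CosetDecomposition

variable [Fintype (G ⧸ H)]

/-- On `j(A)` a comparison of factorisations is prescribed, on `σ(g) j(A)` it is then determined
by equivariance. -/
theorem factorization_iso_unique (D : CosetDecomposition j) {F₁ F₂ : Hom σ π}
    (Φ₁ : F ≅ j.comp (F₁.restrict H)) (Φ₂ : F ≅ j.comp (F₂.restrict H)) {η η' : F₁ ⟶ F₂}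
    (h : Φ₁.hom ≫ whisker j (restrictHom₂ H η) = Φ₂.hom)
    (h' : Φ₁.hom ≫ whisker j (restrictHom₂ H η') = Φ₂.hom) : η = η' := by
  rw [factorAt_whisker] at h h'
  refine Hom₂.ext (D.natTrans_ext fun g A => ?_)
  have e : (Hom₂.nat η).app (j.functor.obj A) = (Hom₂.nat η').app (j.functor.obj A) := by
    rw [← cancel_epi (Frame.factorAt F₁ Φ₁ A).hom, h, h']
  have h1 := Hom₂.comm η g (j.functor.obj A)
  have h2 := Hom₂.comm η' g (j.functor.obj A)
  rw [← cancel_mono ((F₂.equiv g).hom.app (j.functor.obj A)), ← h1, ← h2, e]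

theorem exists_factorization_iso [j.functor.Full] (D : CosetDecomposition j) {F₁ F₂ : Hom σ π}
    (Φ₁ : F ≅ j.comp (F₁.restrict H)) (Φ₂ : F ≅ j.comp (F₂.restrict H)) :
    ∃ θ : F₁ ≅ F₂, Φ₁.hom ≫ whisker j (restrictHom₂ H θ.hom) = Φ₂.hom := by
  -- The frames of `F₁` and `F₂` have the same target, and their comparison extends to `V`.
  set T₁ := Frame.ofFactorization F₁ Φ₁ with hT₁
  set T₂ := Frame.ofFactorization F₂ Φ₂ with hT₂
  obtain ⟨η, hη⟩ := D.exists_natIso (S := F₁.functor) (S' := F₂.functor)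
    (fun g A => T₁.θ g A ≪≫ (T₂.θ g A).symm)
    (fun g A B u => by
      have h1 := T₂.naturality g u
      rw [← Iso.eq_comp_inv, Category.assoc, ← Iso.inv_comp_eq] at h1
      simp only [Iso.trans_hom, Iso.symm_hom, Category.assoc]
      rw [h1, reassoc_of% (T₁.naturality g u)])
    (fun h e A => by
      have h1 := T₂.compat h e A
      rw [← Iso.eq_comp_inv, Category.assoc, ← Iso.inv_comp_eq] at h1
      simp only [Iso.trans_hom, Iso.symm_hom, Category.assoc]
      rw [h1, reassoc_of% (T₁.compat h e A)])
  refine ⟨isoOfNatIso η fun s M => ?_, ?_⟩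
  -- Compatibility with the equivariance isomorphisms.
  · suffices h : (F₁.equiv s).hom ≫ Functor.whiskerRight η.hom (π.ρ s) =
        Functor.whiskerLeft (σ.ρ s) η.hom ≫ (F₂.equiv s).hom from NatTrans.congr_app h M
    refine D.natTrans_ext fun g A => ?_
    change (F₁.equiv s).hom.app _ ≫ (π.ρ s).map (η.hom.app _) =
      η.hom.app ((σ.ρ s).obj _) ≫ (F₂.equiv s).hom.app _
    have h1 := η.hom.naturality ((σ.ψ s g).hom.app (j.functor.obj A))
    rw [← cancel_mono ((π.ρ s).map (T₂.θ g A).hom ≫ (π.ψ s g).hom.app (F.functor.obj A)),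
      Category.assoc, Category.assoc, Frame.ofFactorization_spec, ← reassoc_of% h1, hη, hη,
      ← Functor.map_comp_assoc]
    simp only [← hT₂, Iso.trans_hom, Iso.symm_hom, Category.assoc, Iso.inv_hom_id,
      Category.comp_id]
    exact Frame.ofFactorization_spec F₁ Φ₁ s g A
  -- The value of the comparison on `j(A)` follows from its value on `σ(1) j(A)`.
  · rw [factorAt_whisker]
    intro A
    change _ ≫ η.hom.app (j.functor.obj A) = _
    have h1 := η.hom.naturality (σ.ψ₁.hom.app (j.functor.obj A))
    have h2 := Frame.ofFactorization_one F₁ Φ₁ A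
    have h3 := Frame.ofFactorization_one F₂ Φ₂ A
    dsimp at h1
    rw [← Iso.eq_inv_comp, ← cancel_mono (Frame.factorAt F₂ Φ₂ A).inv,
      ← cancel_epi (F₁.functor.map (σ.ψ₁.hom.app (j.functor.obj A))), reassoc_of% h1, ← h3, hη]
    simp [hT₁, hT₂, h2]

/-- A 2-representation that decomposes along cosets is induced. -/
theorem isInduced.{u₁, v₁, u₂, v₂, u₃, v₃} {W : Type u₁} [Category.{v₁} W] [Preadditive W]
    [Linear k W] [HasFiniteBiproducts W] {V : Type u₂} [Category.{v₂} V] [Preadditive V]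
    [Linear k V] [HasFiniteBiproducts V] {ρ : ProjTwoRep (α.restrict H) W} {σ : ProjTwoRep α V}
    {j : Hom ρ (σ.restrict H)} [j.functor.Full] [j.functor.Faithful]
    (D : CosetDecomposition j) : IsInduced.{u, v, u₁, v₁, u₂, v₂, u₃, v₃} ρ σ j := by
  intro N _ _ _ _ π F
  refine ⟨⟨_, (D.extensionFrame π F).nonempty_factorization D⟩, fun F₁ F₂ Φ₁ Φ₂ => ?_⟩
  obtain ⟨θ, hθ⟩ := D.exists_factorization_iso Φ₁ Φ₂
  exact ⟨θ, hθ, fun θ' hθ' => Iso.ext (D.factorization_iso_unique Φ₁ Φ₂ hθ' hθ)⟩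

end CosetDecomposition
end UniversalProperty
end ProjTwoRep

/-! ### Graded vector spaces supported on a coset -/

namespace GradedVect

section CosetProj

variable {k : Type u} [Field k] {G : Type v} [Group G] [Fintype G] {α : NormalizedCocycle k G}
  (H : Subgroup G) [Fintype H]

/-- The projection of a graded vector space onto the sum of the components with degree in the
coset `gH`. -/
noncomputable def cosetProj (V : GradedVect α) (g : G) : Module.End k V.carrier :=
  ∑ h : H, V.proj (g * h)

theorem cosetProj_of_mem [DecidablePred (· ∈ H)] {V : GradedVect α} {s : G} {x : V.carrier}
    (hx : x ∈ V.component s) (g : G) :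
    cosetProj H V g x = if g⁻¹ * s ∈ H then x else 0 := by
  classical
  simp only [cosetProj, LinearMap.sum_apply, proj_apply_of_mem hx]
  split_ifs with h
  · rw [Finset.sum_eq_single ⟨_, h⟩]
    · simp
    · intro l _ hl
      rw [if_neg]
      rintro rfl
      exact hl (Subtype.ext (by simp))
    · simp
  · refine Finset.sum_eq_zero fun l _ => if_neg ?_
    rintro rfl
    exact h (by simp)

theorem Hom.comm_cosetProj {V W : GradedVect α} (f : V ⟶ W) (g : G) (x : V.carrier) :
    Hom.lin f (cosetProj H V g x) = cosetProj H W g (Hom.lin f x) := by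
  simp only [cosetProj, LinearMap.sum_apply, map_sum, f.comm_apply]

theorem sum_cosetProj [Fintype (G ⧸ H)] (V : GradedVect α) :
    ∑ c : G ⧸ H, cosetProj H V c.out = LinearMap.id := by
  classical
  refine linear_ext fun s x hx => ?_
  simp only [LinearMap.sum_apply, cosetProj_of_mem H hx, ← QuotientGroup.eq,
    QuotientGroup.out_eq', LinearMap.id_apply]
  simp

/-- Tensoring with `k_g` on the left translates the support. -/
theorem cosetProj_line_tensor (V : GradedVect α) (g s : G) :
    cosetProj H (tensor (line α g) V) (g * s) =
      TensorProduct.map LinearMap.id (cosetProj H V s) := by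
  classical
  refine tensor_linear_ext (V := line α g) (W := V) fun a b c hc y hy => ?_
  rw [TensorProduct.map_tmul, cosetProj_of_mem H hy, cosetProj_of_mem H (tmul_mem hc hy)]
  rcases eq_or_eq_zero_of_mem_line hc with rfl | rfl
  · simp only [mul_inv_rev, mul_assoc, inv_mul_cancel_left]
    split_ifs
    · rfl
    · exact (TensorProduct.tmul_zero _ _).symm
  · simp

theorem cosetProj_one_extendObj (V : GradedVect (α.restrict H)) :
    cosetProj H (extendObj V) 1 = LinearMap.id := by
  classical
  refine linear_ext (V := V) fun s x hx => ?_
  rw [cosetProj_of_mem H (mem_extendObj hx)]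
  simp

/-- There are no nonzero morphisms between graded spaces supported on different cosets. -/
theorem hom_eq_zero_of_coset_ne {V W : GradedVect α} {g g' : G}
    (hg : (g : G ⧸ H) ≠ (g' : G ⧸ H)) (hV : cosetProj H V g = LinearMap.id)
    (hW : cosetProj H W g' = LinearMap.id) (f : V ⟶ W) : f = 0 := by
  classical
  apply hom_ext
  refine linear_ext fun s x hx => ?_
  have h1 := LinearMap.congr_fun hV x
  have h2 := LinearMap.congr_fun hW (Hom.lin f x)
  rw [cosetProj_of_mem H hx, ← QuotientGroup.eq] at h1
  rw [cosetProj_of_mem H (Hom.map_mem f hx), ← QuotientGroup.eq] at h2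
  by_cases h : (g : G ⧸ H) = (s : G ⧸ H)
  · rw [if_neg fun h' => hg (h.trans h'.symm)] at h2
    exact h2.symm
  · rw [if_neg h] at h1
    rw [show x = 0 from h1.symm, map_zero, map_zero]

theorem cosetProj_idem (V : GradedVect α) (g : G) (x : V.carrier) :
    cosetProj H V g (cosetProj H V g x) = cosetProj H V g x := by
  classical
  suffices h : cosetProj H V g ∘ₗ cosetProj H V g = cosetProj H V g from LinearMap.congr_fun h x
  refine linear_ext fun s y hy => ?_
  rw [LinearMap.comp_apply, cosetProj_of_mem H hy]
  split_ifs with h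
  · rw [cosetProj_of_mem H hy, if_pos h]
  · exact map_zero _

theorem proj_cosetProj (V : GradedVect α) (g s : G) (x : V.carrier) :
    V.proj s (cosetProj H V g x) = cosetProj H V g (V.proj s x) := by
  classical
  suffices h : V.proj s ∘ₗ cosetProj H V g = cosetProj H V g ∘ₗ V.proj s from
    LinearMap.congr_fun h x
  refine linear_ext fun t y hy => ?_
  rw [LinearMap.comp_apply, LinearMap.comp_apply, cosetProj_of_mem H hy, proj_apply_of_mem hy]
  split_ifs <;> simp_all [proj_apply_of_mem hy, cosetProj_of_mem H hy]

end CosetProj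

section HPart

variable {k : Type u} [Field k] {G : Type v} [Group G] [Fintype G] {α : NormalizedCocycle k G}
  {H : Subgroup G} [Fintype H]

/-- The part of a `G`-graded vector space with degrees in `H`, as an `H`-graded vector space. -/
noncomputable abbrev subgroupPart (V : GradedVect α) : GradedVect (α.restrict H) where
  carrier := LinearMap.range (cosetProj H V 1)
  proj h := (V.proj (h : G)).restrict (by
    rintro _ ⟨x, rfl⟩
    exact ⟨_, (proj_cosetProj H V 1 h x).symm⟩)
  isGrading := by
    rw [CompleteOrthogonalIdempotents.iff_ortho_complete]
    constructor
    · intro g h hgh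
      refine LinearMap.ext fun x => Subtype.ext ?_
      exact LinearMap.congr_fun (V.isGrading.ortho fun e => hgh (Subtype.ext e)) x.1
    · refine LinearMap.ext fun x => Subtype.ext ?_
      obtain ⟨_, y, rfl⟩ := x
      rw [LinearMap.sum_apply, Submodule.coe_sum]
      have h : ∀ z, ∑ h : H, V.proj (h : G) z = cosetProj H V 1 z := fun z => by
        simp [cosetProj]
      exact (h _).trans (cosetProj_idem H V 1 y)

theorem mem_of_mem_subgroupPart {V : GradedVect α} {h : H}
    {x : (subgroupPart (H := H) V).carrier} (hx : x ∈ (subgroupPart (H := H) V).component h) :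
    x.1 ∈ V.component (h : G) :=
  mem_component.2 (congrArg Subtype.val (mem_component.1 hx))

theorem cosetProj_coe_subgroupPart {V : GradedVect α} (x : (subgroupPart (H := H) V).carrier) :
    cosetProj H V 1 x.1 = x.1 := by
  obtain ⟨_, y, rfl⟩ := x
  exact cosetProj_idem H V 1 y

end HPart

section Modules

variable {k : Type u} [Field k] {G : Type v} [Group G] [Fintype G] {α : NormalizedCocycle k G}
  {H : Subgroup G} [Fintype H] {A : GradedVect (α.restrict H)} [MonObj A]

/-- The action of an algebra supported on `H` preserves the decomposition of a module along
the cosets `gH`. -/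
theorem act_cosetProj (M : RightMod ((extend α H).obj A)) (g : G) (x : M.X.carrier)
    (a : A.carrier) :
    Hom.lin M.act (cosetProj H M.X g x ⊗ₜ[k] a : M.X.carrier ⊗[k] A.carrier) =
      cosetProj H M.X g (Hom.lin M.act (x ⊗ₜ[k] a : M.X.carrier ⊗[k] A.carrier)) := by
  classical
  suffices h : (Hom.lin M.act : M.X.carrier ⊗[k] A.carrier →ₗ[k] M.X.carrier) ∘ₗ
      TensorProduct.map (cosetProj H M.X g) LinearMap.id =
        cosetProj H M.X g ∘ₗ Hom.lin M.act from LinearMap.congr_fun h (x ⊗ₜ a)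
  apply TensorProduct.ext
  refine linear_ext fun s y hy => ?_
  refine linear_ext (V := A) fun t b hb => ?_
  have hyb := Hom.map_mem M.act (tmul_mem hy (mem_extendObj hb))
  change Hom.lin M.act (cosetProj H M.X g y ⊗ₜ[k] b : M.X.carrier ⊗[k] A.carrier) =
    cosetProj H M.X g (Hom.lin M.act (y ⊗ₜ[k] b : M.X.carrier ⊗[k] A.carrier))
  rw [cosetProj_of_mem H hyb, cosetProj_of_mem H hy, ← mul_assoc, H.mul_mem_cancel_right t.2]
  split_ifs
  · rfl
  · rw [TensorProduct.zero_tmul]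
    exact map_zero _

/-- The action on the part of a module with degrees in `H`. -/
noncomputable def subgroupPartAct (M : RightMod ((extend α H).obj A)) :
    tensor (subgroupPart M.X) A ⟶ subgroupPart M.X :=
  homOfTmul (U := subgroupPart M.X) (V := A) (W := subgroupPart M.X)
    (LinearMap.codRestrict _ ((Hom.lin M.act : M.X.carrier ⊗[k] A.carrier →ₗ[k] M.X.carrier) ∘ₗ
      TensorProduct.map (Submodule.subtype _) LinearMap.id) (by
        intro z
        induction z using TensorProduct.induction_on with
        | zero => rw [map_zero]; exact Submodule.zero_mem _
        | tmul x a =>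
          obtain ⟨_, y, rfl⟩ := x
          exact ⟨_, (act_cosetProj M 1 y a).symm⟩
        | add x y hx hy => rw [map_add]; exact Submodule.add_mem _ hx hy))
    fun a b x hx y hy => mem_component.2 (Subtype.ext (mem_component.1
      (Hom.map_mem M.act (tmul_mem (mem_of_mem_subgroupPart hx) (mem_extendObj hy)))))

/-- The part of a right module over an extended algebra with degrees in `H`. -/
noncomputable def subgroupPartMod (M : RightMod ((extend α H).obj A)) : RightMod A where
  X := subgroupPart M.X
  act := subgroupPartAct M
  act_one := by
    apply hom_ext
    apply TensorProduct.ext'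
    intro x c
    apply Subtype.ext
    exact LinearMap.congr_fun (congrArg Hom.lin M.act_one) (x.1 ⊗ₜ c)
  act_mul := by
    apply hom_ext
    refine tensor_linear_ext_left (U := subgroupPart M.X) (V := A) (W := A)
      fun a b c x hx y hy z hz => ?_
    apply Subtype.ext
    have h : Hom.lin M.act (Hom.lin M.act (x.1 ⊗ₜ[k] y : M.X.carrier ⊗[k] A.carrier) ⊗ₜ[k] z :
          M.X.carrier ⊗[k] A.carrier) =
        Hom.lin M.act (Hom.lin (M.X ◁ MonObj.mul (X := (extend α H).obj A))
          (assocLin M.X (extendObj A) (extendObj A) ((x.1 ⊗ₜ y) ⊗ₜ z))) :=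
      LinearMap.congr_fun (congrArg Hom.lin M.act_mul) ((x.1 ⊗ₜ y) ⊗ₜ z)
    rw [assocLin_tmul (mem_of_mem_subgroupPart hx) (mem_extendObj hy) (mem_extendObj hz)] at h
    refine h.trans ?_
    change _ = (Hom.lin (subgroupPartAct M) (Hom.lin (subgroupPart M.X ◁ MonObj.mul (X := A))
      (assocLin (subgroupPart M.X) A A ((x ⊗ₜ y) ⊗ₜ z)))).1
    rw [assocLin_tmul hx hy hz]
    erw [map_smul, map_smul, map_smul, map_smul]
    rfl

/-- The inclusion of the part with degrees in `H`. -/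
noncomputable def subgroupPartι (M : RightMod ((extend α H).obj A)) :
    (extendMod α H A).obj (subgroupPartMod M) ⟶ M where
  hom := homOfExtend (V := subgroupPart M.X) (W := M.X) (Submodule.subtype _)
    fun _ _ hx => mem_of_mem_subgroupPart hx
  act_hom := by
    apply hom_ext
    apply TensorProduct.ext'
    intro x a
    rfl

/-- The projection onto the part with degrees in `H`. -/
noncomputable def subgroupPartπ (M : RightMod ((extend α H).obj A)) :
    M ⟶ (extendMod α H A).obj (subgroupPartMod M) where
  hom :=
    { lin := LinearMap.rangeRestrict (cosetProj H M.X 1)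
      comm := fun g => by
        classical
        refine LinearMap.ext fun x => Subtype.ext ?_
        by_cases hg : g ∈ H
        · have h : (extendObj (subgroupPart (H := H) M.X)).proj g =
              (subgroupPart (H := H) M.X).proj ⟨g, hg⟩ := dif_pos hg
          change cosetProj H M.X 1 (M.X.proj g x) =
            ((extendObj (subgroupPart (H := H) M.X)).proj g _).1
          rw [h, ← proj_cosetProj]
          rfl
        · have h : (extendObj (subgroupPart (H := H) M.X)).proj g = 0 := dif_neg hg
          change cosetProj H M.X 1 (M.X.proj g x) =
            ((extendObj (subgroupPart (H := H) M.X)).proj g _).1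
          rw [h, cosetProj_of_mem H (s := g) ⟨x, rfl⟩, if_neg (by simpa using hg)]
          rfl }
  act_hom := by
    apply hom_ext
    apply TensorProduct.ext'
    intro x a
    apply Subtype.ext
    exact (act_cosetProj M 1 x a).symm

theorem subgroupPartι_π (M : RightMod ((extend α H).obj A)) :
    subgroupPartι M ≫ subgroupPartπ M = 𝟙 _ := by
  apply RightMod.hom_ext
  apply hom_ext
  refine LinearMap.ext fun x => Subtype.ext ?_
  exact cosetProj_coe_subgroupPart x

instance extendMod_faithful : (extendMod α H A).Faithful where
  map_injective {_ _ f f'} h := by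
    apply RightMod.hom_ext
    apply hom_ext
    exact congrArg (fun t => Hom.lin (RightMod.Hom.hom t)) h

instance extendMod_full : (extendMod α H A).Full where
  map_surjective {M M'} f := by
    let f₀ : M.X.carrier →ₗ[k] M'.X.carrier :=
      Hom.lin (V := extendObj M.X) (W := extendObj M'.X) (RightMod.Hom.hom f)
    refine ⟨⟨⟨f₀, fun h => ?_⟩, ?_⟩, ?_⟩
    · have h1 := Hom.comm (RightMod.Hom.hom f) (h : G)
      have hM : (extendObj M.X).proj (h : G) = M.X.proj h := dif_pos h.2
      have hM' : (extendObj M'.X).proj (h : G) = M'.X.proj h := dif_pos h.2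
      change _ ∘ₗ (extendObj M.X).proj (h : G) = (extendObj M'.X).proj (h : G) ∘ₗ _ at h1
      rw [hM, hM'] at h1
      exact h1
    · apply hom_ext
      apply TensorProduct.ext'
      intro x a
      exact LinearMap.congr_fun (congrArg Hom.lin f.act_hom) (x ⊗ₜ a)
    · rfl

end Modules

end GradedVect

/-! ### Right modules decompose along cosets -/

namespace GradedVect

section InclusionDecomposition

variable {k : Type u} [Field k] {G : Type v} [Group G] [Fintype G] (α : NormalizedCocycle k G)
  (H : Subgroup G) [Fintype H] (A : GradedVect (α.restrict H)) [MonObj A]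

instance inclusion_full : (inclusion α H A).functor.Full :=
  inferInstanceAs (extendMod α H A).Full

instance inclusion_faithful : (inclusion α H A).functor.Faithful :=
  inferInstanceAs (extendMod α H A).Faithful

variable {α H A}

theorem cosetProj_line_extendObj (g : G) (V : GradedVect (α.restrict H)) :
    cosetProj H (tensor (line α g) (extendObj V)) g = LinearMap.id := by
  have h := cosetProj_line_tensor H (extendObj V) g 1
  rw [mul_one, cosetProj_one_extendObj, TensorProduct.map_id] at h
  exact h

/-- The summand of `M` belonging to the coset `gH`: it is obtained by translating `M` by `g⁻¹`,
taking the part with degrees in `H`, and translating back by `g`. -/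
theorem exists_summand (M : RightMod ((extend α H).obj A)) (g : G) :
    ∃ (N : RightMod A)
      (ι : ((rightModRep α ((extend α H).obj A)).ρ g).obj ((extendMod α H A).obj N) ⟶ M)
      (p : M ⟶ ((rightModRep α ((extend α H).obj A)).ρ g).obj ((extendMod α H A).obj N)),
      ι ≫ p = 𝟙 _ ∧ Hom.lin (RightMod.Hom.hom (p ≫ ι)) = cosetProj H M.X g := by
  let σ := rightModRep α ((extend α H).obj A)
  let κ : (σ.ρ g).obj ((σ.ρ g⁻¹).obj M) ≅ M := (σ.compIsoId (mul_inv_cancel g)).app M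
  let ι' := subgroupPartι ((σ.ρ g⁻¹).obj M)
  let π' := subgroupPartπ ((σ.ρ g⁻¹).obj M)
  refine ⟨subgroupPartMod ((σ.ρ g⁻¹).obj M), (σ.ρ g).map ι' ≫ κ.hom, κ.inv ≫ (σ.ρ g).map π',
    ?_, ?_⟩
  · rw [Category.assoc, κ.hom_inv_id_assoc, ← Functor.map_comp]
    exact (congrArg (σ.ρ g).map (subgroupPartι_π _)).trans ((σ.ρ g).map_id _)
  · have h : Hom.lin (RightMod.Hom.hom ((σ.ρ g).map (π' ≫ ι'))) =
        cosetProj H ((σ.ρ g).obj ((σ.ρ g⁻¹).obj M)).X g := by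
      have h1 := cosetProj_line_tensor H ((σ.ρ g⁻¹).obj M).X g 1
      rw [mul_one] at h1
      exact h1.symm
    have hκ : ∀ x, Hom.lin (RightMod.Hom.hom κ.hom) (Hom.lin (RightMod.Hom.hom κ.inv) x) = x :=
      LinearMap.congr_fun (congrArg (fun t => Hom.lin (RightMod.Hom.hom t)) κ.inv_hom_id)
    refine LinearMap.ext fun x => ?_
    rw [Category.assoc, ← Functor.map_comp_assoc]
    change Hom.lin (RightMod.Hom.hom κ.hom) (Hom.lin (RightMod.Hom.hom ((σ.ρ g).map (π' ≫ ι')))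
      (Hom.lin (RightMod.Hom.hom κ.inv) x)) = _
    rw [h, Hom.comm_cosetProj, hκ]

variable (α H A)

theorem nonempty_cosetDecomposition [Fintype (G ⧸ H)] :
    Nonempty (ProjTwoRep.CosetDecomposition (inclusion α H A)) := by
  refine ProjTwoRep.CosetDecomposition.nonempty_of_objectwise
    (fun {g g'} hg N N' f => RightMod.hom_ext (hom_eq_zero_of_coset_ne H hg
      (cosetProj_line_extendObj g N.X) (cosetProj_line_extendObj g' N'.X) (RightMod.Hom.hom f)))
    fun M => ?_
  choose N ι p hιp hpι using fun c : G ⧸ H => exists_summand M c.out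
  refine ⟨N, ι, p, hιp, ?_⟩
  apply RightMod.hom_ext
  apply hom_ext
  let L : (M ⟶ M) →+ Module.End k M.X.carrier :=
    AddMonoidHom.mk' (fun f => Hom.lin (RightMod.Hom.hom f)) fun _ _ => rfl
  refine (map_sum L _ _).trans ?_
  exact (Finset.sum_congr rfl fun c _ => hpι c).trans (sum_cosetProj H M.X)

end InclusionDecomposition

end GradedVect

theorem mainTheorem8 {k : Type u} [Field k] {G : Type v} [Group G] [Fintype G]
    (α : NormalizedCocycle k G) (H : Subgroup G) [Fintype H]
    (A : GradedVect (α.restrict H)) [MonObj A] :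
    IsInduced (rightModRep (α.restrict H) A)
        (rightModRep α ((GradedVect.extend α H).obj A))
        (GradedVect.inclusion α H A) ∧
      (∀ (M : RightMod A) (h : H),
        ((GradedVect.inclusion α H A).functor.obj M).X.component (h : G) = M.X.component h) ∧
      (∀ (M : RightMod A) (g : G), g ∉ H →
        ((GradedVect.inclusion α H A).functor.obj M).X.component g = ⊥) := by
  have : Fintype (G ⧸ H) := Fintype.ofFinite _
  obtain ⟨D⟩ := GradedVect.nonempty_cosetDecomposition α H A
  exact ⟨D.isInduced, fun M h => GradedVect.component_extendObj M.X h,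
    fun M g hg => GradedVect.component_extendObj_of_notMem M.X hg⟩
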